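/- Let $d\ge 0$, $t_0\in\mathbb R$, $x_0\in\mathbb R^d$, let $g:\mathbb R^d\to\mathbb R^d$ be real-analytic on $\mathbb R^d$, and let $A\in\mathbb R^{d\times d}$ be the generator (transition rate matrix) of a continuous-time Markov chain on $\{1,\dots,d\}$, i.e. $A_{ij}\ge 0$ for $i\ne j$ and $\sum_j A_{ij}=0$ for every $i$. Put $f(x):=Ax+g(x)$ and consider the semilinear ODE $$\dot x(t)=Ax(t)+g(x(t)),\qquad x(t_0)=x_0 .$$ Assume that there is $C>0$ such that $|\nabla^m g(x_0)|+|Ax_0|+|A|\le C$ for all $m\ge 0$ (operator norms with respect to the Euclidean norm). *Trees.* For nonempty rooted trees let $[\tau_1,\dots,\tau_m]$ be the tree obtained by joining the roots of $\tau_1,\dots,\tau_m$ to a new root, and let $\bullet=[\,]$ be the single vertex. The elementary differentials of $f$ are $F(\bullet)=f$ and $F([\tau_1,\dots,\tau_m])=\nabla^m f(F(\tau_1),\dots,F(\tau_m))$. Put $F_g(\emptyset)=\mathrm{Id}$, $F_g(\bullet)=g$ and $F_g([\tau_1,\dots,\tau_m])=\nabla^m g(F(\tau_1),\dots,F(\tau_m))$.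 Write $|\tau|$ for the number of vertices of $\tau$, with $|\emptyset|=0$. *Randomness.* On a probability space let the following three families be independent: the jump times $(T_n)_{n\ge1}$ of a standard Poisson process $(N_t)_{t\ge t_0}$ started at $t_0$, with $T_0:=t_0$; attachment variables $(\eta_k)_{k\ge1}$, independent, with $\eta_k$ uniform on $\{1,\dots,k\}$; and a right-continuous continuous-time Markov chain $(X_s)_{s\ge t_0}$ on $\{1,\dots,d\}$ with generator $A$. Let $\mathcal T_t$ be the random tree of order $N_t$ obtained from a root labelled $1$ by successively attaching, for $k=1,\dots,N_t-1$, a new vertex labelled $k+1$ to the vertex labelled $\eta_k$, and then forgetting the labels ($\mathcal T_t=\emptyset$ if $N_t=0$). Then the ODE has a solution on $[t_0,t_0+1/C)$, and for every solution $x$ on an interval $[t_0,T]$, every $t\in[t_0,T]$ with $t<t_0+1/C$ and every $i\in\{1,\dots,d\}$ with $\mathbb P(X_{t_0}=i)>0$, the random variable below is integrable given $X_{t_0}=i$ and $$x_i(t)=e^{t-t_0}\,\mathbb E\Big[\big((|\mathcal T_t|-1)\vee 0\big)!\,\big(F_g(\mathcal T_t)(x_0)\big)_{X_{t_0+t-T_{|\mathcal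 T_t|}}}\mathbf 1_{\{T_{|\mathcal T_t|}\le t\}}\;\Big|\;X_{t_0}=i\Big].$$ -/

import Mathlib

open MeasureTheory ProbabilityTheory Set

noncomputable section

/-! ### Rooted trees and elementary differentials -/

/-- Nonempty rooted trees, with the `B⁺` operation as constructor: `node m c` is the tree
`[c 0, …, c (m - 1)]`, and `node 0 _` is the single vertex. Listings of the same subtrees in a
different order present the same rooted tree, see `RootTree.Iso`. -/
inductive RootTree : Type
  | node (m : ℕ) (c : Fin m → RootTree) : RootTree

namespace RootTree

/-- Two terms present the same (unordered) rooted tree. -/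
inductive Iso : RootTree → RootTree → Prop
  | node {m : ℕ} (e : Equiv.Perm (Fin m)) (c c' : Fin m → RootTree)
      (h : ∀ i, Iso (c i) (c' (e i))) : Iso (.node m c) (.node m c')

/-- The number of vertices of a nonempty rooted tree. -/
def order : RootTree → ℕ
  | node _ c => 1 + ∑ i, (c i).order

variable {E : Type*} [NormedAddCommGroup E] [NormedSpace ℝ E]

/-- The elementary differential `F(τ)` of `f` on nonempty trees:
`F([τ₁, …, τₘ]) = ∇ᵐ f (F(τ₁), …, F(τₘ))`; in particular `F(•) = f`. -/
def elemDiff (f : E → E) : RootTree → E → E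
  | node m c => fun x => iteratedFDeriv ℝ m f x (fun i => (c i).elemDiff f x)

/-- The elementary differential does not depend on the order in which subtrees are listed. -/
theorem elemDiff_eq_of_iso {f : E → E} (hf : AnalyticOnNhd ℝ f univ) {s t : RootTree}
    (h : Iso s t) : s.elemDiff f = t.elemDiff f := by
  induction h with
  | @node m e c c' _ ih =>
    funext x
    have h1 : (fun i => (c i).elemDiff f x) = (fun i => (c' i).elemDiff f x) ∘ e := by
      funext i
      simp [ih i]
    simp only [elemDiff]
    rw [h1]
    exact hf.analyticOn.iteratedFDeriv_comp_perm _ e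

end RootTree

/-- Rooted trees, including the empty tree `none`. -/
abbrev ButcherTree : Type := Option RootTree

namespace ButcherTree

/-- The order `|τ|` of a tree, with `|∅| = 0`. -/
def order : ButcherTree → ℕ
  | none => 0
  | some τ => τ.order

variable {E : Type*} [NormedAddCommGroup E] [NormedSpace ℝ E]

/-- The elementary differential `F_g(τ)` of `g` relative to the vector field `f`:
`F_g(∅) = Id`, `F_g(•) = g` and `F_g([τ₁, …, τₘ]) = ∇ᵐ g (F(τ₁), …, F(τₘ))`, where `F` is the
elementary differential of `f`. -/
def elemDiffOf (f g : E → E) : ButcherTree → E → E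
  | none => id
  | some (.node m c) => fun x => iteratedFDeriv ℝ m g x (fun i => (c i).elemDiff f x)

end ButcherTree

/-! ### Labelled trees and uniform attachment -/

/-- Nonempty rooted trees whose vertices carry labels. -/
inductive LabelledTree : Type
  | node (label : ℕ) (m : ℕ) (c : Fin m → LabelledTree) : LabelledTree

namespace LabelledTree

/-- Forget the labels. -/
def forget : LabelledTree → RootTree
  | node _ m c => .node m (fun i => (c i).forget)

/-- Attach a new vertex with label `new`, as a child, to the vertex with label `l`. -/
def attach (l new : ℕ) : LabelledTree → LabelledTree
  | node a m c =>
    if a = l then node a (m + 1) (Fin.cons (node new 0 Fin.elim0) c)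
    else node a m (fun i => (c i).attach l new)

/-- The labelled tree of order `n + 1` grown from the root labelled `1`: the vertices with labels
`2, …, n + 1` are attached one after the other, the vertex with label `k + 2` being attached to
the vertex with label `l k`. -/
def grow (l : ℕ → ℕ) : ℕ → LabelledTree
  | 0 => node 1 0 Fin.elim0
  | n + 1 => (grow l n).attach (l n) (n + 2)

end LabelledTree

/-- The tree of order `n` grown with the attachment labels `l`, as an unlabelled tree;
it is empty for `n = 0`. -/
def attachmentTree (l : ℕ → ℕ) : ℕ → ButcherTree
  | 0 => none
  | n + 1 => some (LabelledTree.grow l n).forget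

/-! ### The stochastic ingredients -/

section Probability

variable {Ω : Type*} [MeasurableSpace Ω]

/-- `T 1, T 2, …` are the jump times of a standard (rate one) Poisson process started at time
`t₀ = T 0`. -/
structure IsPoissonJumpTimes (P : Measure Ω) (t₀ : ℝ) (T : ℕ → Ω → ℝ) : Prop where
  measurable : ∀ n, Measurable (T n)
  start : ∀ ω, T 0 ω = t₀
  law : ∀ n, P.map (fun ω => T (n + 1) ω - T n ω) = expMeasure 1
  indep : iIndepFun (fun n ω => T (n + 1) ω - T n ω) P

/-- The counting process `N_t = #{n ≥ 1 : T_n ≤ t}`. -/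
def jumpCount (T : ℕ → Ω → ℝ) (t : ℝ) (ω : Ω) : ℕ :=
  {n : ℕ | 1 ≤ n ∧ T n ω ≤ t}.ncard

/-- Independent attachment labels: `η k`, the label of the vertex to which the vertex `k + 2` is
attached, is uniform on `{1, …, k + 1}`. -/
structure IsUniformAttachment (P : Measure Ω) (η : ℕ → Ω → ℕ) : Prop where
  measurable : ∀ k, Measurable (η k)
  law : ∀ k, P.map (η k) = uniformOn (Icc 1 (k + 1))
  indep : iIndepFun η P

/-- Generators (transition rate matrices) of continuous-time Markov chains on `{1, …, d}`. -/
structure IsGenerator {d : ℕ} (A : Matrix (Fin d) (Fin d) ℝ) : Prop where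
  nonneg : ∀ i j, i ≠ j → 0 ≤ A i j
  row_sum : ∀ i, ∑ j, A i j = 0

/-- `(X s)_{s ≥ t₀}` is a right-continuous continuous-time Markov chain with generator `A`: its
finite-dimensional distributions are those given by the transition matrices `exp (s A)`. -/
structure IsMarkovChain (P : Measure Ω) (t₀ : ℝ) {d : ℕ} (A : Matrix (Fin d) (Fin d) ℝ)
    (X : ℝ → Ω → Fin d) : Prop where
  measurable : ∀ s, t₀ ≤ s → Measurable (X s)
  rightCts : ∀ ω s, t₀ ≤ s → ContinuousWithinAt (fun u => X u ω) (Ici s) s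
  fdd : ∀ (n : ℕ) (s : ℕ → ℝ) (i : ℕ → Fin d), Monotone s → s 0 = t₀ →
    P.real {ω | ∀ k ≤ n, X (s k) ω = i k} =
      P.real {ω | X t₀ ω = i 0} *
        ∏ k ∈ Finset.range n, NormedSpace.exp ((s (k + 1) - s k) • A) (i k) (i (k + 1))

/-- The random tree `𝒯_t`, grown by uniform attachment up to the Poisson size `N_t`. -/
def randomTree (T : ℕ → Ω → ℝ) (η : ℕ → Ω → ℕ) (t : ℝ) (ω : Ω) : ButcherTree :=
  attachmentTree (fun k => η k ω) (jumpCount T t ω)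

end Probability

/-! ### The semilinear equation -/

/-- `x` solves `x' = A x + g(x)`, `x(t₀) = x₀`, on the time interval `J`
(with initial point `t₀`). -/
structure SolvesSemilinear {d : ℕ} (A : Matrix (Fin d) (Fin d) ℝ)
    (g : EuclideanSpace ℝ (Fin d) → EuclideanSpace ℝ (Fin d)) (t₀ : ℝ)
    (x₀ : EuclideanSpace ℝ (Fin d)) (J : Set ℝ) (x : ℝ → EuclideanSpace ℝ (Fin d)) : Prop where
  init : x t₀ = x₀
  cont : ContinuousOn x J
  ode : ∀ t ∈ J, t₀ < t →
    HasDerivWithinAt x (Matrix.toEuclideanCLM (𝕜 := ℝ) A (x t) + g (x t)) J t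

/-- The random variable
`((|𝒯_t| - 1) ∨ 0)! (F_g(𝒯_t)(x₀))_{X_{t₀ + t - T_{|𝒯_t|}}} 1_{T_{|𝒯_t|} ≤ t}`. -/
def treeFunctional {Ω : Type*} {d : ℕ} (A : Matrix (Fin d) (Fin d) ℝ)
    (g : EuclideanSpace ℝ (Fin d) → EuclideanSpace ℝ (Fin d)) (t₀ : ℝ)
    (x₀ : EuclideanSpace ℝ (Fin d)) (T : ℕ → Ω → ℝ) (η : ℕ → Ω → ℕ) (X : ℝ → Ω → Fin d)
    (t : ℝ) (ω : Ω) : ℝ :=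
  let τ : ButcherTree := randomTree T η t ω
  ((τ.order - 1).factorial : ℝ) *
    (τ.elemDiffOf (fun y => Matrix.toEuclideanCLM (𝕜 := ℝ) A y + g y) g x₀)
      (X (t₀ + t - T τ.order ω) ω) *
    (if T τ.order ω ≤ t then 1 else 0)

end

/-! Write `f = A + g`. Duhamel's formula gives `x(t) = e^{(t-t₀)A} x₀ + ∫ e^{(t-s)A} g(x(s)) ds`,
and the probabilistic formula is this identity with `g ∘ x` expanded at `t₀` and every factor read
as a probability.

Trees: along a solution, `d/ds` acts on `h ∘ x` as the Lie derivative `h ↦ Dh·f`. By the Leibniz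
rule this attaches one new vertex, in all possible ways, to the tree of an elementary differential
(`lieDeriv_elemDiffOf`). Hence the `n`-th derivative of `g ∘ x` at `t₀` is a sum over `n!`
increasingly labelled trees of order `n + 1` (`iterate_lieDeriv`). Uniform attachment gives each of
them weight `1/n!`, so the sum is `n!` times an expectation (`IsUniformAttachment.integral_grow`).

Times: on the event of `n + 1` jumps, `T (n + 1)` has density `e^{-(t-t₀)} (s-t₀)^n / n!` on `(t₀,
t]`, the Taylor weight up to a constant. The chain started at `i` and run for time `t - s` supplies
the row `i` of `e^{(t-s)A}`. Without jumps one obtains the homogeneous term.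

Convergence: each tree of order `n + 1` contributes at most `C^(n+1)`, so the Taylor series has
radius at least `1/C` and the stages of the expectation are dominated by powers of `C (t - t₀) < 1`.
The series itself furnishes the solution: its jet at `t₀` is that of a local Picard–Lindelöf
solution, and analyticity carries the equation to the whole ball (`hasDerivAt_seriesSolution`). -/

noncomputable section

/-! ### Combinatorics of labelled trees. -/

namespace LabelledTree

/-- The multiset of the labels of a labelled tree. -/
def labels : LabelledTree → Multiset ℕ
  | node a _ c => a ::ₘ ∑ i, (c i).labels

theorem order_forget (τ : LabelledTree) : τ.forget.order = τ.labels.card := by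
  induction τ with
  | node a m c ih => simp [forget, labels, RootTree.order, ih, add_comm]

theorem attach_of_notMem {l new : ℕ} {τ : LabelledTree} (h : l ∉ τ.labels) :
    τ.attach l new = τ := by
  induction τ with
  | node a m c ih =>
    simp only [labels, Multiset.mem_cons, Multiset.mem_sum, not_or, Finset.mem_univ, true_and,
      not_exists] at h
    rw [attach, if_neg (fun e => h.1 e.symm)]
    congr 1
    funext i
    exact ih i (h.2 i)

theorem nodup_labels_node {a m : ℕ} {c : Fin m → LabelledTree} (h : (node a m c).labels.Nodup) :
    (∀ i, a ∉ (c i).labels) ∧ (∀ i, (c i).labels.Nodup) ∧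
      ∀ i j, i ≠ j → ∀ l ∈ (c i).labels, l ∉ (c j).labels := by
  rw [labels, Multiset.nodup_cons] at h
  refine ⟨fun i hi => h.1 (Multiset.mem_sum.2 ⟨i, Finset.mem_univ i, hi⟩), fun i => ?_, ?_⟩
  · exact Multiset.nodup_of_le
      (Finset.single_le_sum (f := fun i => (c i).labels) (fun _ _ => Multiset.zero_le _)
        (Finset.mem_univ i)) h.2
  · intro i j hij l hi hj
    have hle : (c i).labels + (c j).labels ≤ ∑ i, (c i).labels := by
      rw [← Finset.sum_pair (f := fun i => (c i).labels) hij]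
      exact Finset.sum_le_sum_of_subset (Finset.subset_univ _)
    have := (Multiset.nodup_add.1 (Multiset.nodup_of_le hle h.2)).2.2
    exact Multiset.disjoint_left.1 this hi hj

/-- Distinct labels confine the attachment to a single subtree, as the Leibniz rule differentiates
one argument at a time. -/
theorem attach_node_of_mem {a m l new : ℕ} {c : Fin m → LabelledTree}
    (h : (node a m c).labels.Nodup) {i : Fin m} (hl : l ∈ (c i).labels) :
    (node a m c).attach l new = node a m (Function.update c i ((c i).attach l new)) := by
  obtain ⟨h1, -, h3⟩ := nodup_labels_node h
  have hne : a ≠ l := fun e => h1 i (e ▸ hl)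
  rw [attach, if_neg hne]
  congr 1
  funext j
  by_cases hj : j = i
  · subst hj; simp
  · rw [Function.update_of_ne hj]
    exact attach_of_notMem (h3 i j (Ne.symm hj) l hl)

theorem labels_attach {l new : ℕ} {τ : LabelledTree} (h : τ.labels.Nodup) (hl : l ∈ τ.labels) :
    (τ.attach l new).labels = new ::ₘ τ.labels := by
  induction τ with
  | node a m c ih =>
    by_cases hal : a = l
    · rw [attach, if_pos hal]
      simp only [labels, Fin.sum_univ_succ, Fin.cons_zero, Fin.cons_succ]
      simp [Multiset.cons_swap]
    · obtain ⟨i, -, hi⟩ : ∃ i ∈ Finset.univ, l ∈ (c i).labels := by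
        rw [labels, Multiset.mem_cons, Multiset.mem_sum] at hl
        exact hl.resolve_left (fun e => hal e.symm)
      rw [attach_node_of_mem h hi]
      have h2 : ∀ j, (Function.update c i ((c i).attach l new) j).labels
          = Function.update (fun j => (c j).labels) i (new ::ₘ (c i).labels) j := by
        intro j
        by_cases hj : j = i
        · subst hj; simp [ih j ((nodup_labels_node h).2.1 j) hi]
        · simp [hj]
      simp only [labels, h2]
      rw [Finset.sum_update_of_mem (Finset.mem_univ i), Multiset.cons_add, Multiset.cons_swap,
        Finset.sdiff_singleton_eq_erase, Finset.add_sum_erase _ (fun j => (c j).labels)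
          (Finset.mem_univ i)]

/-- The increasingly labelled trees of order `n + 1`, with labels `1, …, n + 1`. -/
def growths : ℕ → Multiset LabelledTree
  | 0 => {node 1 0 Fin.elim0}
  | n + 1 => (growths n).bind fun τ =>
      (Finset.Icc 1 (n + 1)).val.map fun l => τ.attach l (n + 2)

theorem labels_of_mem_growths {n : ℕ} {τ : LabelledTree} (h : τ ∈ growths n) :
    τ.labels = (Finset.Icc 1 (n + 1)).val := by
  induction n generalizing τ with
  | zero =>
    rw [growths, Multiset.mem_singleton] at h
    subst h
    simp [labels]
  | succ n ih =>
    rw [growths, Multiset.mem_bind] at h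
    obtain ⟨σ, hσ, hτ⟩ := h
    obtain ⟨l, hl, rfl⟩ := Multiset.mem_map.1 hτ
    rw [labels_attach (by rw [ih hσ]; exact Finset.nodup _) (by rwa [ih hσ]), ih hσ]
    rw [← Finset.insert_Icc_right_eq_Icc_add_one (by omega : 1 ≤ n + 1 + 1),
      Finset.insert_val_of_notMem (by simp)]
    rfl

theorem order_of_mem_growths {n : ℕ} {τ : LabelledTree} (h : τ ∈ growths n) :
    τ.forget.order = n + 1 := by
  rw [order_forget, labels_of_mem_growths h]
  simp

theorem card_growths (n : ℕ) : (growths n).card = n.factorial := by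
  induction n with
  | zero => simp [growths]
  | succ n ih =>
    rw [growths, Multiset.card_bind]
    simp [ih, Nat.factorial_succ, mul_comm]

theorem grow_mem_growths {l : ℕ → ℕ} (n : ℕ) (h : ∀ k < n, l k ∈ Finset.Icc 1 (k + 1)) :
    grow l n ∈ growths n := by
  induction n with
  | zero => simp [grow, growths]
  | succ n ih =>
    rw [grow, growths, Multiset.mem_bind]
    exact ⟨_, ih fun k hk => h k (by omega), Multiset.mem_map.2 ⟨l n, h n (by omega), rfl⟩⟩

theorem grow_congr {l l' : ℕ → ℕ} (n : ℕ) (h : ∀ k < n, l k = l' k) : grow l n = grow l' n := by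
  induction n with
  | zero => rfl
  | succ n ih => rw [grow, grow, ih fun k hk => h k (by omega), h n (by omega)]

end LabelledTree

/-! ### Elementary differentials and Lie derivatives. -/

section ElementaryDifferentials

variable {E : Type*} [NormedAddCommGroup E] [NormedSpace ℝ E]

open LabelledTree

theorem elemDiffOf_self (f : E → E) (τ : RootTree) :
    ButcherTree.elemDiffOf f f (some τ) = τ.elemDiff f := by
  cases τ; rfl

/-- The exponent `⊤` in `ContDiff ℝ ⊤` is the analytic class `ω`, which is stable under
differentiation. -/
theorem RootTree.differentiable_elemDiff {f : E → E} (hf : ContDiff ℝ ⊤ f) (τ : RootTree) :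
    Differentiable ℝ (τ.elemDiff f) := by
  induction τ with
  | node m c ih =>
    intro z
    exact (HasFDerivAt.continuousMultilinearMap_apply
      (((hf.contDiffAt.iteratedFDeriv_right (m := 1) (i := m) le_top).differentiableAt
        (by simp)).hasFDerivAt) (fun i => ((ih i) z).hasFDerivAt)).differentiableAt

/-- The derivative of `h` along the vector field `f`. -/
def lieDeriv (f h : E → E) : E → E := fun z => fderiv ℝ h z (f z)

theorem hasFDerivAt_elemDiffOf {f h : E → E} (hf : ContDiff ℝ ⊤ f) (hh : ContDiff ℝ ⊤ h)
    (m : ℕ) (c : Fin m → RootTree) (z : E) :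
    HasFDerivAt (ButcherTree.elemDiffOf f h (some (.node m c)))
      ((ContinuousMultilinearMap.apply ℝ (fun _ : Fin m => E) E
          fun i => (c i).elemDiff f z) ∘SL fderiv ℝ (iteratedFDeriv ℝ m h) z +
        ∑ i, (iteratedFDeriv ℝ m h z).toContinuousLinearMap (fun i => (c i).elemDiff f z) i ∘SL
          fderiv ℝ ((c i).elemDiff f) z) z :=
  HasFDerivAt.continuousMultilinearMap_apply
    (((hh.contDiffAt.iteratedFDeriv_right (m := 1) (i := m) le_top).differentiableAt
        (by simp)).hasFDerivAt)
    (fun i => (RootTree.differentiable_elemDiff hf (c i) z).hasFDerivAt)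

theorem differentiable_elemDiffOf {f h : E → E} (hf : ContDiff ℝ ⊤ f) (hh : ContDiff ℝ ⊤ h)
    (τ : RootTree) : Differentiable ℝ (ButcherTree.elemDiffOf f h (some τ)) := by
  cases τ with
  | node m c => exact fun z => (hasFDerivAt_elemDiffOf hf hh m c z).differentiableAt

/-- Differentiating an elementary differential along `f` attaches one more vertex in all possible
ways. -/
theorem lieDeriv_elemDiffOf {f h : E → E} (hf : ContDiff ℝ ⊤ f) (hh : ContDiff ℝ ⊤ h)
    (new : ℕ) (τ : LabelledTree) (hτ : τ.labels.Nodup) (z : E) :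
    lieDeriv f (ButcherTree.elemDiffOf f h (some τ.forget)) z =
      (τ.labels.map fun l =>
        ButcherTree.elemDiffOf f h (some (τ.attach l new).forget) z).sum := by
  -- `h` has to vary: the root carries `∇ᵐ h` but the subtrees carry differentials of `f`, so the
  -- induction hypothesis is used with `h = f`.
  induction τ generalizing h with
  | node a m c ih =>
    rw [lieDeriv, forget, (hasFDerivAt_elemDiffOf hf hh m _ z).fderiv, labels, Multiset.map_cons,
      Multiset.sum_cons]
    simp only [add_apply, ContinuousLinearMap.comp_apply,
      sum_apply]
    congr 1
    -- The derivative falls on `∇ᵐ h`: a leaf is added at the root, and `F(•) = f` fills the new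
    -- first slot.
    · rw [attach, if_pos rfl, forget]
      simp only [ButcherTree.elemDiffOf]
      rw [iteratedFDeriv_succ_apply_left]
      simp only [Fin.cons_zero, forget, RootTree.elemDiff, iteratedFDeriv_zero_apply]
      rfl
    -- The derivative falls on the argument `i`: the vertex is added somewhere in the subtree `i`.
    · rw [← Multiset.coe_mapAddMonoidHom, map_sum, ← Multiset.coe_sumAddMonoidHom, map_sum]
      refine Finset.sum_congr rfl fun i _ => ?_
      have h1 := ih i hf ((nodup_labels_node hτ).2.1 i)
      rw [elemDiffOf_self, lieDeriv] at h1
      rw [h1, map_multiset_sum, Multiset.map_map]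
      simp only [Multiset.coe_mapAddMonoidHom, Multiset.coe_sumAddMonoidHom]
      congr 1
      refine Multiset.map_congr rfl fun l hl => ?_
      rw [attach_node_of_mem hτ hl, Function.comp_apply, elemDiffOf_self]
      simp only [forget, ButcherTree.elemDiffOf]
      change iteratedFDeriv ℝ m h z _ = _
      congr 1
      funext j
      by_cases hj : j = i
      · subst hj; simp
      · simp [hj]

/-- Iterated derivatives along `f` are sums of elementary differentials. -/
theorem iterate_lieDeriv {f h : E → E} (hf : ContDiff ℝ ⊤ f) (hh : ContDiff ℝ ⊤ h)
    (n : ℕ) : (lieDeriv f)^[n] h = fun z =>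
      ((growths n).map fun τ => ButcherTree.elemDiffOf f h (some τ.forget) z).sum := by
  induction n with
  | zero =>
    funext z
    simp [growths, forget, ButcherTree.elemDiffOf]
  | succ n ih =>
    rw [Function.iterate_succ_apply', ih]
    funext z
    have hd : ∀ s : Multiset LabelledTree, HasFDerivAt (fun z =>
        (s.map fun τ => ButcherTree.elemDiffOf f h (some τ.forget) z).sum)
        (s.map fun τ => fderiv ℝ (ButcherTree.elemDiffOf f h (some τ.forget)) z).sum z := by
      intro s
      induction s using Multiset.induction_on with
      | empty => simpa using hasFDerivAt_const (0 : E) z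
      | cons τ s ihs =>
        simp only [Multiset.map_cons, Multiset.sum_cons]
        exact (differentiable_elemDiffOf hf hh _ z).hasFDerivAt.add ihs
    rw [lieDeriv, (hd _).fderiv, growths, Multiset.map_bind, Multiset.sum_bind]
    have happ : ∀ s : Multiset (E →L[ℝ] E), s.sum (f z) = (s.map fun L => L (f z)).sum := by
      intro s
      induction s using Multiset.induction_on with
      | empty => simp
      | cons L s ihs => simp [ihs]
    rw [happ, Multiset.map_map]
    congr 1
    refine Multiset.map_congr rfl fun τ hτ => ?_
    have hl := labels_of_mem_growths hτ
    have := lieDeriv_elemDiffOf hf hh (n + 2) τ (by rw [hl]; exact Finset.nodup _) z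
    rw [hl] at this
    simpa [lieDeriv, Multiset.map_map, Function.comp_def] using this

/-- Every vertex contributes one operator norm, hence one factor `C`. -/
theorem RootTree.norm_elemDiff_le {f : E → E} {x₀ : E} {C : ℝ} (hC : 0 ≤ C)
    (hb : ∀ m, ‖iteratedFDeriv ℝ m f x₀‖ ≤ C) (τ : RootTree) :
    ‖τ.elemDiff f x₀‖ ≤ C ^ τ.order := by
  induction τ with
  | node m c ih =>
    rw [elemDiff, order, pow_add, pow_one, ← Finset.prod_pow_eq_pow_sum]
    refine (ContinuousMultilinearMap.le_opNorm _ _).trans ?_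
    exact mul_le_mul (hb m) (Finset.prod_le_prod (fun _ _ => norm_nonneg _) fun i _ => ih i)
      (Finset.prod_nonneg fun _ _ => norm_nonneg _) hC

theorem norm_elemDiffOf_le {f h : E → E} {x₀ : E} {C : ℝ} (hC : 0 ≤ C)
    (hf : ∀ m, ‖iteratedFDeriv ℝ m f x₀‖ ≤ C) (hh : ∀ m, ‖iteratedFDeriv ℝ m h x₀‖ ≤ C)
    (τ : RootTree) : ‖ButcherTree.elemDiffOf f h (some τ) x₀‖ ≤ C ^ τ.order := by
  cases τ with
  | node m c =>
    rw [ButcherTree.elemDiffOf, RootTree.order, pow_add, pow_one, ← Finset.prod_pow_eq_pow_sum]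
    refine (ContinuousMultilinearMap.le_opNorm _ _).trans ?_
    exact mul_le_mul (hh m) (Finset.prod_le_prod (fun _ _ => norm_nonneg _)
      fun i _ => RootTree.norm_elemDiff_le hC hf (c i))
      (Finset.prod_nonneg fun _ _ => norm_nonneg _) hC

/-- There are `n!` trees of order `n + 1`, each contributing at most `C ^ (n + 1)`. -/
theorem norm_iterate_lieDeriv_le {f h : E → E} (hf : ContDiff ℝ ⊤ f) (hh : ContDiff ℝ ⊤ h)
    {x₀ : E} {C : ℝ} (hC : 0 ≤ C) (hfb : ∀ m, ‖iteratedFDeriv ℝ m f x₀‖ ≤ C)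
    (hhb : ∀ m, ‖iteratedFDeriv ℝ m h x₀‖ ≤ C) (n : ℕ) :
    ‖(lieDeriv f)^[n] h x₀‖ ≤ n.factorial * C ^ (n + 1) := by
  rw [iterate_lieDeriv hf hh]
  refine (norm_multiset_sum_le _).trans ?_
  rw [Multiset.map_map, ← card_growths n, ← nsmul_eq_mul]
  refine (Multiset.sum_le_card_nsmul _ (C ^ (n + 1)) fun x hx => ?_).trans (by simp)
  obtain ⟨τ, hτ, rfl⟩ := Multiset.mem_map.1 hx
  rw [← order_of_mem_growths hτ]
  exact norm_elemDiffOf_le hC hfb hhb _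

theorem contDiff_lieDeriv {f h : E → E} (hf : ContDiff ℝ ⊤ f) (hh : ContDiff ℝ ⊤ h) :
    ContDiff ℝ ⊤ (lieDeriv f h) :=
  (hh.fderiv_right le_top).clm_apply hf

end ElementaryDifferentials

/-! ### Jets of compositions along solutions. -/

section Autonomous

open Filter Topology

variable {E F : Type*} [NormedAddCommGroup E] [NormedSpace ℝ E]
  [NormedAddCommGroup F] [NormedSpace ℝ F]

/-- Bootstrapping: if `x` is of class `C^n`, so is `x' = f ∘ x`. -/
theorem contDiffOn_of_hasDerivAt_autonomous {f : E → E} (hf : ContDiff ℝ ⊤ f) {U : Set ℝ}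
    (hU : IsOpen U) {x : ℝ → E} (hx : ∀ t ∈ U, HasDerivAt x (f (x t)) t) (n : ℕ) :
    ContDiffOn ℝ n x U := by
  induction n with
  | zero => exact contDiffOn_zero.2 fun t ht => (hx t ht).continuousAt.continuousWithinAt
  | succ n ih =>
    push_cast
    rw [contDiffOn_succ_iff_deriv_of_isOpen hU]
    refine ⟨fun t ht => (hx t ht).differentiableAt.differentiableWithinAt, by simp, ?_⟩
    exact ((hf.of_le le_top).comp_contDiffOn ih).congr fun t ht => (hx t ht).deriv

/-- The chain rule gives `(h ∘ x)' = (lieDeriv f h) ∘ x`; the induction replaces `h` by its Lie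
derivative. -/
theorem iteratedDeriv_comp_autonomous {f h : E → E} (hf : ContDiff ℝ ⊤ f)
    (hh : ContDiff ℝ ⊤ h) {U : Set ℝ} (hU : IsOpen U) {x : ℝ → E}
    (hx : ∀ t ∈ U, HasDerivAt x (f (x t)) t) (n : ℕ) {t : ℝ} (ht : t ∈ U) :
    iteratedDeriv n (h ∘ x) t = (lieDeriv f)^[n] h (x t) := by
  induction n generalizing h t with
  | zero => simp
  | succ n ih =>
    rw [iteratedDeriv_succ', Function.iterate_succ_apply, ← ih (contDiff_lieDeriv hf hh) ht]
    refine Filter.EventuallyEq.iteratedDeriv_eq n ?_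
    filter_upwards [hU.mem_nhds ht] with s hs
    exact ((hh.differentiable (by simp) (x s)).hasFDerivAt.comp_hasDerivAt s (hx s hs)).deriv

/-- Faà di Bruno's formula at a point. -/
theorem iteratedFDeriv_comp_eq_taylorComp {h : E → F} (hh : ContDiff ℝ ⊤ h) {x : ℝ → E}
    {t : ℝ} {n : ℕ} (hx : ContDiffAt ℝ n x t) :
    iteratedFDeriv ℝ n (h ∘ x) t =
      (ftaylorSeries ℝ h (x t)).taylorComp (ftaylorSeries ℝ x t) n := by
  -- Regularity at the point only gives a Taylor series nearby, so the formula is applied within an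
  -- open `V`, where derivatives within `V` are ordinary ones.
  obtain ⟨U, hU, hxU⟩ := hx.contDiffOn (m := n) le_rfl (by simp)
  obtain ⟨V, hVU, hV, htV⟩ := mem_nhds_iff.1 (by simpa using hU)
  have h1 : HasFTaylorSeriesUpToOn n x (ftaylorSeriesWithin ℝ x V) V :=
    (hxU.mono hVU).ftaylorSeriesWithin hV.uniqueDiffOn
  have h2 : HasFTaylorSeriesUpToOn n h (ftaylorSeries ℝ h) univ :=
    ((contDiff_iff_ftaylorSeries (n := (n : ℕ∞))).1 (hh.of_le le_top)).hasFTaylorSeriesUpToOn univ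
  have h3 := (h2.comp h1 (mapsTo_univ _ _)).eq_iteratedFDerivWithin_of_uniqueDiffOn
    (m := n) le_rfl hV.uniqueDiffOn htV
  rw [iteratedFDerivWithin_of_isOpen n hV htV] at h3
  rw [← h3]
  congr 1
  funext k
  exact iteratedFDerivWithin_of_isOpen k hV htV

/-- By Faà di Bruno the jet of `h ∘ x` at `t` depends on `x` through its jet alone. This allows
passing from a genuine solution to the power series. -/
theorem iteratedDeriv_comp_congr {h : E → F} (hh : ContDiff ℝ ⊤ h) {x y : ℝ → E} {t : ℝ}
    (n : ℕ) (hx : ContDiffAt ℝ n x t) (hy : ContDiffAt ℝ n y t)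
    (hxy : ∀ k, iteratedDeriv k x t = iteratedDeriv k y t) :
    iteratedDeriv n (h ∘ x) t = iteratedDeriv n (h ∘ y) t := by
  have h0 : x t = y t := by simpa using hxy 0
  have h1 : ftaylorSeries ℝ x t = ftaylorSeries ℝ y t := by
    funext k
    simp only [ftaylorSeries, iteratedFDeriv_eq_equiv_comp, Function.comp_apply, hxy k]
  rw [iteratedDeriv_eq_iteratedFDeriv, iteratedDeriv_eq_iteratedFDeriv,
    iteratedFDeriv_comp_eq_taylorComp hh hx, iteratedFDeriv_comp_eq_taylorComp hh hy, h0, h1]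

end Autonomous

/-! ### Vector-valued power series and the identity theorem. -/

section PowerSeries

open Filter Topology

variable {E : Type*} [NormedAddCommGroup E] [NormedSpace ℝ E] [CompleteSpace E]

theorem hasFPowerSeriesOnBall_tsum_pow_smul {c : ℕ → E} {C K : ℝ} (hC : 0 < C)
    (hc : ∀ n, ‖c n‖ ≤ K * C ^ n) (t₀ : ℝ) :
    HasFPowerSeriesOnBall (fun t : ℝ => ∑' n, (t - t₀) ^ n • c n)
      (fun n => ContinuousMultilinearMap.mkPiRing ℝ (Fin n) (c n)) t₀
      (ENNReal.ofReal (1 / C)) := by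
  set p : FormalMultilinearSeries ℝ ℝ E :=
    fun n => ContinuousMultilinearMap.mkPiRing ℝ (Fin n) (c n) with hp
  have hr : ENNReal.ofReal (1 / C) ≤ p.radius := by
    refine p.le_radius_of_bound (r := (1 / C).toNNReal) K fun n => ?_
    rw [hp, ContinuousMultilinearMap.norm_mkPiRing, Real.coe_toNNReal _ (by positivity)]
    calc ‖c n‖ * (1 / C) ^ n ≤ K * C ^ n * (1 / C) ^ n := by gcongr; exact hc n
      _ = K := by rw [mul_assoc, ← mul_pow, mul_one_div_cancel hC.ne', one_pow, mul_one]
  have h0 : (0 : ENNReal) < ENNReal.ofReal (1 / C) := by simpa using hC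
  have h1 := ((p.hasFPowerSeriesOnBall (h0.trans_le hr)).mono h0 hr).comp_sub t₀
  rw [zero_add] at h1
  convert h1 using 1
  funext t
  simp [FormalMultilinearSeries.sum, hp]

theorem hasSum_tsum_pow_smul {c : ℕ → E} {C K : ℝ} (hC : 0 < C)
    (hc : ∀ n, ‖c n‖ ≤ K * C ^ n) (t₀ : ℝ) {t : ℝ} (ht : t ∈ Metric.ball t₀ (1 / C)) :
    HasSum (fun n => (t - t₀) ^ n • c n) (∑' n, (t - t₀) ^ n • c n) := by
  have h := (hasFPowerSeriesOnBall_tsum_pow_smul hC hc t₀).hasSum (y := t - t₀)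
    (by rw [Metric.eball_ofReal]; simpa [Real.dist_eq] using ht)
  simpa using h

theorem analyticOnNhd_tsum_pow_smul {c : ℕ → E} {C K : ℝ} (hC : 0 < C)
    (hc : ∀ n, ‖c n‖ ≤ K * C ^ n) (t₀ : ℝ) :
    AnalyticOnNhd ℝ (fun t : ℝ => ∑' n, (t - t₀) ^ n • c n) (Metric.ball t₀ (1 / C)) := by
  rw [← Metric.eball_ofReal]
  exact (hasFPowerSeriesOnBall_tsum_pow_smul hC hc t₀).analyticOnNhd

theorem iteratedDeriv_tsum_pow_smul {c : ℕ → E} {C K : ℝ} (hC : 0 < C)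
    (hc : ∀ n, ‖c n‖ ≤ K * C ^ n) (t₀ : ℝ) (n : ℕ) :
    iteratedDeriv n (fun t : ℝ => ∑' n, (t - t₀) ^ n • c n) t₀ = (n.factorial : ℝ) • c n := by
  have h := (hasFPowerSeriesOnBall_tsum_pow_smul hC hc t₀).factorial_smul 1 n
  rw [iteratedDeriv_eq_iteratedFDeriv, ← h]
  simp [Nat.cast_smul_eq_nsmul]

/-- The derivatives determine the power series at `t₀`, so the functions agree near `t₀`, and the
identity theorem extends this to the connected ball. -/
theorem eqOn_ball_of_iteratedDeriv_eq {u v : ℝ → E} {t₀ r : ℝ} (hr : 0 < r)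
    (hu : AnalyticOnNhd ℝ u (Metric.ball t₀ r)) (hv : AnalyticOnNhd ℝ v (Metric.ball t₀ r))
    (h : ∀ n, iteratedDeriv n u t₀ = iteratedDeriv n v t₀) : EqOn u v (Metric.ball t₀ r) := by
  have hmem : t₀ ∈ Metric.ball t₀ r := Metric.mem_ball_self hr
  refine hu.eqOn_of_preconnected_of_eventuallyEq hv (convex_ball t₀ r).isPreconnected hmem ?_
  obtain ⟨p, a, hp⟩ := hu t₀ hmem
  obtain ⟨q, b, hq⟩ := hv t₀ hmem
  have hpq : ∀ n (y : ℝ), (p n fun _ => y) = q n fun _ => y := by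
    intro n y
    have h1 := hp.factorial_smul y n
    have h2 := hq.factorial_smul y n
    have h3 : iteratedFDeriv ℝ n u t₀ = iteratedFDeriv ℝ n v t₀ := by
      simp only [iteratedFDeriv_eq_equiv_comp, Function.comp_apply, h n]
    rw [h3, ← h2, ← Nat.cast_smul_eq_nsmul ℝ, ← Nat.cast_smul_eq_nsmul ℝ] at h1
    exact smul_right_injective E (Nat.cast_ne_zero.2 (Nat.factorial_ne_zero n)) h1
  filter_upwards [hp.hasFPowerSeriesAt.eventually_hasSum_sub,
    hq.hasFPowerSeriesAt.eventually_hasSum_sub] with t h1 h2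
  simp only [hpq] at h1
  exact h1.unique h2

end PowerSeries

/-! ### The power series solution. -/

section AnalyticSolution

open Filter Topology

variable {E : Type*} [NormedAddCommGroup E] [NormedSpace ℝ E] [CompleteSpace E]

/-- The Taylor coefficients at the initial time of the solution of `x' = f x`, `x t₀ = x₀`. -/
def taylorCoeff (f : E → E) (x₀ : E) : ℕ → E
  | 0 => x₀
  | n + 1 => ((n + 1).factorial : ℝ)⁻¹ • (lieDeriv f)^[n] f x₀

/-- The power series solution of `x' = f x`, `x t₀ = x₀`. -/
def seriesSolution (f : E → E) (t₀ : ℝ) (x₀ : E) (t : ℝ) : E :=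
  ∑' n, (t - t₀) ^ n • taylorCoeff f x₀ n

variable {f : E → E} {x₀ : E} {C : ℝ}

-- The factor `max 1 ‖x₀‖` serves only the coefficient `n = 0`; the others satisfy the bound `n!
-- C^(n+1) / (n+1)! ≤ C^(n+1)`.
omit [CompleteSpace E] in
theorem norm_taylorCoeff_le (hf : ContDiff ℝ ⊤ f) (hC : 0 < C)
    (hfb : ∀ m, ‖iteratedFDeriv ℝ m f x₀‖ ≤ C) (n : ℕ) :
    ‖taylorCoeff f x₀ n‖ ≤ max 1 ‖x₀‖ * C ^ n := by
  cases n with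
  | zero => simp [taylorCoeff]
  | succ n =>
    rw [taylorCoeff, norm_smul, norm_inv, RCLike.norm_natCast]
    calc ((n + 1).factorial : ℝ)⁻¹ * ‖(lieDeriv f)^[n] f x₀‖
        ≤ ((n + 1).factorial : ℝ)⁻¹ * ((n + 1).factorial * C ^ (n + 1)) := by
          gcongr
          refine (norm_iterate_lieDeriv_le hf hf hC.le hfb hfb n).trans ?_
          gcongr
          omega
      _ = 1 * C ^ (n + 1) := by
          rw [← mul_assoc, inv_mul_cancel₀ (by positivity)]
      _ ≤ _ := by gcongr; exact le_max_left _ _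

omit [CompleteSpace E] in
theorem seriesSolution_self {t₀ : ℝ} : seriesSolution f t₀ x₀ t₀ = x₀ := by
  rw [seriesSolution, tsum_eq_single 0]
  · simp [taylorCoeff]
  · intro n hn
    simp [hn]

/-- The series is not yet known to solve the equation. A local Picard–Lindelöf solution has the same
jet at `t₀`, and its compositions have Lie derivatives as jets. -/
theorem iteratedDeriv_comp_seriesSolution (hf : ContDiff ℝ ⊤ f) (hC : 0 < C)
    (hfb : ∀ m, ‖iteratedFDeriv ℝ m f x₀‖ ≤ C) {h : E → E} (hh : ContDiff ℝ ⊤ h) (t₀ : ℝ)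
    (n : ℕ) :
    iteratedDeriv n (h ∘ seriesSolution f t₀ x₀) t₀ = (lieDeriv f)^[n] h x₀ := by
  obtain ⟨x, hx0, ε, hε, hx⟩ :=
    ContDiffAt.exists_forall_mem_closedBall_exists_eq_forall_mem_Ioo_hasDerivAt₀
      (hf.contDiffAt.of_le (m := 1) (x := x₀) le_top) t₀
  have ht : t₀ ∈ Ioo (t₀ - ε) (t₀ + ε) := by constructor <;> linarith
  have hball : t₀ ∈ Metric.ball t₀ (1 / C) := Metric.mem_ball_self (by positivity)
  have hjet : ∀ k, iteratedDeriv k x t₀ = iteratedDeriv k (seriesSolution f t₀ x₀) t₀ := by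
    intro k
    refine Eq.trans ?_
      (iteratedDeriv_tsum_pow_smul hC (norm_taylorCoeff_le hf hC hfb) t₀ k).symm
    cases k with
    | zero => simp [taylorCoeff, hx0]
    | succ k =>
      rw [taylorCoeff, smul_inv_smul₀ (by positivity), ← hx0,
        ← iteratedDeriv_comp_autonomous hf hf isOpen_Ioo hx k ht, iteratedDeriv_succ']
      refine Filter.EventuallyEq.iteratedDeriv_eq k ?_
      filter_upwards [isOpen_Ioo.mem_nhds ht] with s hs
      exact (hx s hs).deriv
  refine (iteratedDeriv_comp_congr hh n
    ((contDiffOn_of_hasDerivAt_autonomous hf isOpen_Ioo hx n).contDiffAt (isOpen_Ioo.mem_nhds ht))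
    ((analyticOnNhd_tsum_pow_smul hC (norm_taylorCoeff_le hf hC hfb) t₀ t₀ hball).contDiffAt)
    hjet).symm.trans ?_
  rw [iteratedDeriv_comp_autonomous hf hh isOpen_Ioo hx n ht, hx0]

theorem analyticOnNhd_comp_seriesSolution (hf : ContDiff ℝ ⊤ f) (hC : 0 < C)
    (hfb : ∀ m, ‖iteratedFDeriv ℝ m f x₀‖ ≤ C) {h : E → E} (hh : AnalyticOnNhd ℝ h univ)
    (t₀ : ℝ) : AnalyticOnNhd ℝ (h ∘ seriesSolution f t₀ x₀) (Metric.ball t₀ (1 / C)) :=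
  hh.comp (analyticOnNhd_tsum_pow_smul hC (norm_taylorCoeff_le hf hC hfb) t₀) (mapsTo_univ _ _)

/-- With `y` the series, `y'` and `f ∘ y` are analytic on the ball and have equal jets at `t₀`. -/
theorem hasDerivAt_seriesSolution (hf : AnalyticOnNhd ℝ f univ) (hC : 0 < C)
    (hfb : ∀ m, ‖iteratedFDeriv ℝ m f x₀‖ ≤ C) (t₀ : ℝ) {t : ℝ}
    (ht : t ∈ Metric.ball t₀ (1 / C)) :
    HasDerivAt (seriesSolution f t₀ x₀) (f (seriesSolution f t₀ x₀ t)) t := by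
  have hf' : ContDiff ℝ ⊤ f := contDiff_omega_iff_analyticOnNhd.2 hf
  have hy := analyticOnNhd_tsum_pow_smul hC (norm_taylorCoeff_le hf' hC hfb) t₀
  have h1 := eqOn_ball_of_iteratedDeriv_eq (by positivity) hy.deriv
    (analyticOnNhd_comp_seriesSolution hf' hC hfb hf t₀) (fun n => by
      rw [iteratedDeriv_comp_seriesSolution hf' hC hfb hf', ← iteratedDeriv_succ',
        iteratedDeriv_tsum_pow_smul hC (norm_taylorCoeff_le hf' hC hfb) t₀, taylorCoeff,
        smul_inv_smul₀ (by positivity)]) ht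
  have h2 := (hy t ht).differentiableAt.hasDerivAt
  rw [h1] at h2
  exact h2

/-- The identity theorem, applied to `h ∘ y` and its Taylor series: the tree bound makes the latter
converge on the whole ball of radius `1 / C`. -/
theorem hasSum_comp_seriesSolution (hf : ContDiff ℝ ⊤ f) (hC : 0 < C)
    (hfb : ∀ m, ‖iteratedFDeriv ℝ m f x₀‖ ≤ C) {h : E → E} (hh : AnalyticOnNhd ℝ h univ)
    (hhb : ∀ m, ‖iteratedFDeriv ℝ m h x₀‖ ≤ C) (t₀ : ℝ) {t : ℝ}
    (ht : t ∈ Metric.ball t₀ (1 / C)) :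
    HasSum (fun n : ℕ => ((t - t₀) ^ n / n.factorial) • (lieDeriv f)^[n] h x₀)
      (h (seriesSolution f t₀ x₀ t)) := by
  have hh' : ContDiff ℝ ⊤ h := contDiff_omega_iff_analyticOnNhd.2 hh
  have hc : ∀ n : ℕ, ‖(n.factorial : ℝ)⁻¹ • (lieDeriv f)^[n] h x₀‖ ≤ C * C ^ n := by
    intro n
    rw [norm_smul, norm_inv, RCLike.norm_natCast, inv_mul_le_iff₀ (by positivity), ← pow_succ']
    exact norm_iterate_lieDeriv_le hf hh' hC.le hfb hhb n
  have h1 := eqOn_ball_of_iteratedDeriv_eq (by positivity)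
    (analyticOnNhd_tsum_pow_smul hC hc t₀)
    (analyticOnNhd_comp_seriesSolution hf hC hfb hh t₀) (fun n => by
      rw [iteratedDeriv_comp_seriesSolution hf hC hfb hh', iteratedDeriv_tsum_pow_smul hC hc,
        smul_inv_smul₀ (by positivity)]) ht
  have h2 := hasSum_tsum_pow_smul hC hc t₀ ht
  simp only at h1
  rw [h1] at h2
  simpa [smul_smul, div_eq_mul_inv] using h2

end AnalyticSolution

/-! ### Entries of the matrix exponential. -/

section MatrixExponential

variable {d : ℕ} (A : Matrix (Fin d) (Fin d) ℝ)

attribute [local instance] Matrix.linftyOpNormedRing Matrix.linftyOpNormedAlgebra in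
theorem hasDerivAt_exp_smul_apply (i j : Fin d) (s : ℝ) :
    HasDerivAt (fun u : ℝ => NormedSpace.exp (u • A) i j)
      (∑ k, NormedSpace.exp (s • A) i k * A k j) s := by
  have h := hasDerivAt_exp_smul_const (𝕂 := ℝ) A s
  have h2 := ((Matrix.entryLinearMap ℝ ℝ i j).toContinuousLinearMap).hasFDerivAt.comp_hasDerivAt s h
  exact h2

theorem continuous_exp_smul_apply (i j : Fin d) :
    Continuous fun u : ℝ => NormedSpace.exp (u • A) i j :=
  continuous_iff_continuousAt.2 fun s => (hasDerivAt_exp_smul_apply A i j s).continuousAt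

theorem toEuclideanCLM_apply_apply (v : EuclideanSpace ℝ (Fin d)) (i : Fin d) :
    Matrix.toEuclideanCLM (𝕜 := ℝ) A v i = ∑ j, A i j * v j := by
  rw [← WithLp.toLp_ofLp 2 v, Matrix.toEuclideanCLM_toLp]
  rfl

end MatrixExponential

/-! ### Uniqueness for autonomous equations. -/

section Uniqueness

open Filter Topology

variable {E : Type*} [NormedAddCommGroup E] [NormedSpace ℝ E] [FiniteDimensional ℝ E]

/-- Both curves stay in one closed ball, where `f` is Lipschitz, so the Grönwall uniqueness theorem
applies. -/
theorem eqOn_Icc_of_hasDerivAt_autonomous {f : E → E} (hf : ContDiff ℝ ⊤ f) {a b : ℝ}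
    {x y : ℝ → E} (hx : ContinuousOn x (Icc a b)) (hy : ContinuousOn y (Icc a b))
    (hx' : ∀ t ∈ Ioo a b, HasDerivAt x (f (x t)) t)
    (hy' : ∀ t ∈ Ioo a b, HasDerivAt y (f (y t)) t) (h : x a = y a) : EqOn x y (Icc a b) := by
  have hcompact : IsCompact (x '' Icc a b ∪ y '' Icc a b) :=
    (isCompact_Icc.image_of_continuousOn hx).union (isCompact_Icc.image_of_continuousOn hy)
  obtain ⟨R, hR⟩ := hcompact.isBounded.subset_closedBall 0
  obtain ⟨M, hM⟩ := (isCompact_closedBall (0 : E) R).exists_bound_of_continuousOn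
    ((hf.continuous_fderiv (by simp)).continuousOn)
  have hlip : LipschitzOnWith M.toNNReal f (Metric.closedBall 0 R) := by
    refine Convex.lipschitzOnWith_of_nnnorm_fderiv_le (𝕜 := ℝ)
      (fun z _ => hf.differentiable (by simp) z) (fun z hz => ?_) (convex_closedBall 0 R)
    rw [← NNReal.coe_le_coe, coe_nnnorm]
    exact (hM z hz).trans (Real.le_coe_toNNReal M)
  -- The equation is not assumed at `a`; the right derivative there is the limit of the derivatives
  -- from the right.
  have right : ∀ z : ℝ → E, ContinuousOn z (Icc a b) →
      (∀ t ∈ Ioo a b, HasDerivAt z (f (z t)) t) →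
      ∀ t ∈ Ico a b, HasDerivWithinAt z (f (z t)) (Ici t) t := by
    intro z hz hz' t ht
    rcases eq_or_lt_of_le ht.1 with rfl | hlt
    · have hab : a < b := ht.2
      refine hasDerivWithinAt_Ici_of_tendsto_deriv (s := Ioo a b)
        (fun s hs => (hz' s hs).differentiableAt.differentiableWithinAt)
        ((hz a ⟨le_rfl, hab.le⟩).mono Ioo_subset_Icc_self) (Ioo_mem_nhdsGT hab) ?_
      have h1 : Tendsto z (𝓝[Ioo a b] a) (𝓝 (z a)) :=
        (hz a ⟨le_rfl, hab.le⟩).mono Ioo_subset_Icc_self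
      have h2 : Tendsto z (𝓝[>] a) (𝓝 (z a)) := by rwa [nhdsWithin_Ioo_eq_nhdsGT hab] at h1
      refine ((hf.continuous.tendsto _).comp h2).congr' ?_
      filter_upwards [Ioo_mem_nhdsGT hab] with s hs
      exact (hz' s hs).deriv.symm
    · exact (hz' t ⟨hlt, ht.2⟩).hasDerivWithinAt
  exact ODE_solution_unique_of_mem_Icc_right (v := fun _ => f)
    (s := fun _ => Metric.closedBall 0 R) (fun _ _ => hlip) hx (right x hx hx')
    (fun t ht => hR (Or.inl ⟨t, Ico_subset_Icc_self ht, rfl⟩)) hy (right y hy hy')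
    (fun t ht => hR (Or.inr ⟨t, Ico_subset_Icc_self ht, rfl⟩)) h

end Uniqueness

/-! ### The semilinear equation and Duhamel's formula. -/

section Semilinear

open Filter Topology

variable {d : ℕ} {A : Matrix (Fin d) (Fin d) ℝ}
  {g : EuclideanSpace ℝ (Fin d) → EuclideanSpace ℝ (Fin d)} {t₀ : ℝ}
  {x₀ : EuclideanSpace ℝ (Fin d)} {C : ℝ}

/-- The vector field `x ↦ A x + g x`. -/
abbrev semilinearField (A : Matrix (Fin d) (Fin d) ℝ)
    (g : EuclideanSpace ℝ (Fin d) → EuclideanSpace ℝ (Fin d)) :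
    EuclideanSpace ℝ (Fin d) → EuclideanSpace ℝ (Fin d) :=
  fun y => Matrix.toEuclideanCLM (𝕜 := ℝ) A y + g y

theorem analyticOnNhd_semilinearField (hg : AnalyticOnNhd ℝ g univ) :
    AnalyticOnNhd ℝ (semilinearField A g) univ :=
  (ContinuousLinearMap.analyticOnNhd _ _).add hg

/-- The linear part contributes `A x₀` at order 0, `A` at order 1 and nothing beyond. -/
theorem norm_iteratedFDeriv_semilinearField_le (hg : AnalyticOnNhd ℝ g univ)
    (hbound : ∀ m : ℕ, ‖iteratedFDeriv ℝ m g x₀‖ + ‖Matrix.toEuclideanCLM (𝕜 := ℝ) A x₀‖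
      + ‖Matrix.toEuclideanCLM (𝕜 := ℝ) A‖ ≤ C) (m : ℕ) :
    ‖iteratedFDeriv ℝ m (semilinearField A g) x₀‖ ≤ C := by
  set L := Matrix.toEuclideanCLM (n := Fin d) (𝕜 := ℝ) A with hL
  have hL1 : ‖iteratedFDeriv ℝ m L x₀‖ ≤ ‖L x₀‖ + ‖L‖ := by
    match m with
    | 0 => simp
    | 1 =>
      rw [norm_iteratedFDeriv_one, ContinuousLinearMap.fderiv]
      linarith [norm_nonneg (L x₀)]
    | m + 2 =>
      rw [← norm_iteratedFDeriv_fderiv]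
      have : fderiv ℝ L = fun _ => (L : EuclideanSpace ℝ (Fin d) →L[ℝ] EuclideanSpace ℝ (Fin d)) := by
        funext z
        exact L.fderiv
      rw [this, iteratedFDeriv_succ_const]
      simp only [Pi.zero_apply, norm_zero]
      positivity
  have hadd : iteratedFDeriv ℝ m (semilinearField A g) x₀ =
      iteratedFDeriv ℝ m L x₀ + iteratedFDeriv ℝ m g x₀ :=
    iteratedFDeriv_add_apply (f := L) (g := g) (L.contDiff.contDiffAt)
      ((contDiff_omega_iff_analyticOnNhd.2 hg).of_le le_top).contDiffAt
  rw [hadd]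
  have := norm_add_le (iteratedFDeriv ℝ m L x₀) (iteratedFDeriv ℝ m g x₀)
  linarith [hbound m]

theorem solvesSemilinear_seriesSolution (hg : AnalyticOnNhd ℝ g univ) (hC : 0 < C)
    (hfb : ∀ m, ‖iteratedFDeriv ℝ m (semilinearField A g) x₀‖ ≤ C) :
    SolvesSemilinear A g t₀ x₀ (Ico t₀ (t₀ + 1 / C))
      (seriesSolution (semilinearField A g) t₀ x₀) := by
  have hd : ∀ t ∈ Ico t₀ (t₀ + 1 / C), HasDerivAt (seriesSolution (semilinearField A g) t₀ x₀)
      (semilinearField A g (seriesSolution (semilinearField A g) t₀ x₀ t)) t := fun t ht =>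
    hasDerivAt_seriesSolution (analyticOnNhd_semilinearField hg) hC hfb t₀ (by
      rw [Metric.mem_ball, Real.dist_eq, abs_of_nonneg (by linarith [ht.1])]; linarith [ht.2])
  exact ⟨seriesSolution_self, fun t ht => (hd t ht).continuousAt.continuousWithinAt,
    fun t ht _ => (hd t ht).hasDerivWithinAt⟩

theorem SolvesSemilinear.eq_seriesSolution (hg : AnalyticOnNhd ℝ g univ) (hC : 0 < C)
    (hfb : ∀ m, ‖iteratedFDeriv ℝ m (semilinearField A g) x₀‖ ≤ C) {b : ℝ}
    {x : ℝ → EuclideanSpace ℝ (Fin d)} (hx : SolvesSemilinear A g t₀ x₀ (Icc t₀ b) x)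
    {t : ℝ} (ht : t ∈ Icc t₀ b) (htC : t < t₀ + 1 / C) :
    x t = seriesSolution (semilinearField A g) t₀ x₀ t := by
  have hball : ∀ s ∈ Icc t₀ t, s ∈ Metric.ball t₀ (1 / C) := fun s hs => by
    rw [Metric.mem_ball, Real.dist_eq, abs_of_nonneg (by linarith [hs.1])]; linarith [hs.2]
  have hy : ∀ s ∈ Icc t₀ t, HasDerivAt (seriesSolution (semilinearField A g) t₀ x₀)
      (semilinearField A g (seriesSolution (semilinearField A g) t₀ x₀ s)) s := fun s hs =>
    hasDerivAt_seriesSolution (analyticOnNhd_semilinearField hg) hC hfb t₀ (hball s hs)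
  refine eqOn_Icc_of_hasDerivAt_autonomous
    (contDiff_omega_iff_analyticOnNhd.2 (analyticOnNhd_semilinearField hg))
    (hx.cont.mono (Icc_subset_Icc_right ht.2))
    (fun s hs => (hy s hs).continuousAt.continuousWithinAt)
    (fun s hs => ?_) (fun s hs => hy s (Ioo_subset_Icc_self hs))
    (by rw [hx.init, seriesSolution_self]) ⟨ht.1, le_rfl⟩
  exact (hx.ode s ⟨hs.1.le, hs.2.le.trans ht.2⟩ hs.1).hasDerivAt
    (Icc_mem_nhds hs.1 (hs.2.trans_le ht.2))

/-- Duhamel's formula. -/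
theorem duhamel_apply {y : ℝ → EuclideanSpace ℝ (Fin d)} {t : ℝ} (ht : t₀ ≤ t)
    (hg : Continuous g)
    (hy : ∀ s ∈ Icc t₀ t, HasDerivAt y (semilinearField A g (y s)) s) (i : Fin d) :
    ∫ s in t₀..t, ∑ j, NormedSpace.exp ((t - s) • A) i j * g (y s) j =
      y t i - ∑ j, NormedSpace.exp ((t - t₀) • A) i j * y t₀ j := by
  have hM : ∀ j s, HasDerivAt (fun s : ℝ => NormedSpace.exp ((t - s) • A) i j)
      (-∑ k, NormedSpace.exp ((t - s) • A) i k * A k j) s := by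
    intro j s
    have := (hasDerivAt_exp_smul_apply A i j (t - s)).comp s ((hasDerivAt_id s).const_sub t)
    simpa [Function.comp_def] using this
  have hyj : ∀ s ∈ Icc t₀ t, ∀ j, HasDerivAt (fun s => y s j)
      (∑ k, A j k * y s k + g (y s) j) s := by
    intro s hs j
    have := (EuclideanSpace.proj (𝕜 := ℝ) j).hasFDerivAt.comp_hasDerivAt s (hy s hs)
    rw [← toEuclideanCLM_apply_apply]
    exact this
  -- Variation of constants: in the derivative of `e^{(t-s)A} y(s)` the two terms containing `A`
  -- cancel.
  have hW : ∀ s ∈ uIcc t₀ t, HasDerivAt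
      (fun s => ∑ j, NormedSpace.exp ((t - s) • A) i j * y s j)
      (∑ j, NormedSpace.exp ((t - s) • A) i j * g (y s) j) s := by
    intro s hs
    rw [uIcc_of_le ht] at hs
    refine (HasDerivAt.fun_sum fun j (_ : j ∈ Finset.univ) =>
      (hM j s).mul (hyj s hs j)).congr_deriv ?_
    rw [Finset.sum_add_distrib]
    simp only [mul_add, Finset.sum_add_distrib, neg_mul, Finset.sum_neg_distrib, Finset.sum_mul,
      Finset.mul_sum]
    rw [Finset.sum_comm]
    simp only [mul_assoc]
    ring
  have hcont : ContinuousOn (fun s => ∑ j, NormedSpace.exp ((t - s) • A) i j * g (y s) j)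
      (uIcc t₀ t) := by
    rw [uIcc_of_le ht]
    have hyc : ContinuousOn y (Icc t₀ t) := fun s hs => (hy s hs).continuousAt.continuousWithinAt
    refine continuousOn_finsetSum _ fun j _ => ContinuousOn.mul ?_ ?_
    · exact ((continuous_exp_smul_apply A i j).comp (by fun_prop)).continuousOn
    · exact (EuclideanSpace.proj (𝕜 := ℝ) j).continuous.comp_continuousOn
        (hg.comp_continuousOn hyc)
  rw [intervalIntegral.integral_eq_sub_of_hasDerivAt hW hcont.intervalIntegrable]
  simp [Matrix.one_apply]

/-- The series obtained by inserting the Taylor expansion of `g ∘ x` into Duhamel's formula. -/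
theorem hasSum_duhamel (hg : AnalyticOnNhd ℝ g univ) (hC : 0 < C)
    (hgb : ∀ m, ‖iteratedFDeriv ℝ m g x₀‖ ≤ C)
    (hfb : ∀ m, ‖iteratedFDeriv ℝ m (semilinearField A g) x₀‖ ≤ C) {t : ℝ} (ht : t₀ ≤ t)
    (htC : t < t₀ + 1 / C) (i : Fin d) :
    HasSum (fun n : ℕ => ∫ s in t₀..t, ∑ j, NormedSpace.exp ((t - s) • A) i j *
        ((s - t₀) ^ n / n.factorial * ((lieDeriv (semilinearField A g))^[n] g x₀) j))
      (seriesSolution (semilinearField A g) t₀ x₀ t i -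
        ∑ j, NormedSpace.exp ((t - t₀) • A) i j * x₀ j) := by
  have hball : ∀ s ∈ Icc t₀ t, s ∈ Metric.ball t₀ (1 / C) := fun s hs => by
    rw [Metric.mem_ball, Real.dist_eq, abs_of_nonneg (by linarith [hs.1])]; linarith [hs.2]
  have hf := analyticOnNhd_semilinearField (A := A) hg
  have hf' : ContDiff ℝ ⊤ (semilinearField A g) := contDiff_omega_iff_analyticOnNhd.2 hf
  have hg' : ContDiff ℝ ⊤ g := contDiff_omega_iff_analyticOnNhd.2 hg
  have hd := duhamel_apply ht hg'.continuous
    (fun s hs => hasDerivAt_seriesSolution hf hC hfb t₀ (hball s hs)) i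
  rw [seriesSolution_self] at hd
  rw [← hd]
  have hpc : Continuous fun s => ∑ j, |NormedSpace.exp ((t - s) • A) i j| :=
    continuous_finsetSum _ fun j _ =>
      ((continuous_exp_smul_apply A i j).comp (by fun_prop)).abs
  -- `K` bounds the absolute sums of row `i` of `e^{(t-s)A}`; the Taylor terms are then dominated by
  -- a geometric series.
  obtain ⟨K, hK⟩ := (isCompact_Icc (a := t₀) (b := t)).exists_bound_of_continuousOn
    hpc.continuousOn
  have hsum : Summable fun n : ℕ => K * ((t - t₀) ^ n * C ^ (n + 1)) := by
    have : Summable fun n : ℕ => ((t - t₀) * C) ^ n :=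
      summable_geometric_of_lt_one (mul_nonneg (by linarith) hC.le) (by
        rw [← lt_div_iff₀ hC]; linarith)
    refine (this.mul_left (K * C)).congr fun n => ?_
    rw [mul_pow, pow_succ]; ring
  refine intervalIntegral.hasSum_integral_of_dominated_convergence
    (fun n _ => K * ((t - t₀) ^ n * C ^ (n + 1))) (fun n => ?_) (fun n => ?_) ?_ ?_ ?_
  · refine Continuous.aestronglyMeasurable (continuous_finsetSum _ fun j _ => ?_)
    exact ((continuous_exp_smul_apply A i j).comp (by fun_prop)).mul (by fun_prop)
  · refine Eventually.of_forall fun s hs => ?_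
    rw [uIoc_of_le ht] at hs
    have hs' : s ∈ Icc t₀ t := ⟨hs.1.le, hs.2⟩
    have h0 : 0 ≤ s - t₀ := by linarith [hs.1]
    have hterm : ∀ j, |(s - t₀) ^ n / n.factorial *
        ((lieDeriv (semilinearField A g))^[n] g x₀) j| ≤ (t - t₀) ^ n * C ^ (n + 1) := by
      intro j
      have h1 := (PiLp.norm_apply_le ((lieDeriv (semilinearField A g))^[n] g x₀) j).trans
        (norm_iterate_lieDeriv_le hf' hg' hC.le hfb hgb n)
      rw [abs_mul, abs_of_nonneg (by positivity)]
      calc (s - t₀) ^ n / n.factorial * |((lieDeriv (semilinearField A g))^[n] g x₀) j|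
          ≤ (t - t₀) ^ n / n.factorial * (n.factorial * C ^ (n + 1)) := by
            have h2 : s ≤ t := hs.2
            have h3 : 0 ≤ t - t₀ := by linarith
            rw [Real.norm_eq_abs] at h1
            gcongr
        _ = _ := by field_simp
    have hK0 := hK s hs'
    rw [Real.norm_of_nonneg (Finset.sum_nonneg fun j _ => abs_nonneg _)] at hK0
    calc _ ≤ ∑ j, |NormedSpace.exp ((t - s) • A) i j * _| := Finset.abs_sum_le_sum_abs _ _
      _ ≤ ∑ j, |NormedSpace.exp ((t - s) • A) i j| * ((t - t₀) ^ n * C ^ (n + 1)) := by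
          refine Finset.sum_le_sum fun j _ => ?_
          rw [abs_mul]
          exact mul_le_mul_of_nonneg_left (hterm j) (abs_nonneg _)
      _ ≤ _ := by
          rw [← Finset.sum_mul]
          refine mul_le_mul_of_nonneg_right hK0 ?_
          exact mul_nonneg (pow_nonneg (by linarith) _) (by positivity)
  · exact Eventually.of_forall fun s _ => hsum
  · exact intervalIntegrable_const
  · refine Eventually.of_forall fun s hs => ?_
    rw [uIoc_of_le ht] at hs
    have h1 := hasSum_comp_seriesSolution hf' hC hfb hg hgb t₀ (hball s ⟨hs.1.le, hs.2⟩)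
    refine hasSum_sum fun j _ => HasSum.mul_left _ ?_
    have h2 := (EuclideanSpace.proj (𝕜 := ℝ) j).hasSum h1
    simpa [Function.comp_def] using h2

end Semilinear

/-! ### Laws of the Poisson jump times. -/

section Poisson

open Filter Topology
open scoped ENNReal

theorem lintegral_expMeasure_one {h : ℝ → ℝ≥0∞} (hh : Measurable h) :
    ∫⁻ r, h r ∂(expMeasure 1) = ∫⁻ r in Ioi 0, ENNReal.ofReal (Real.exp (-r)) * h r := by
  change ∫⁻ r, h r ∂(volume.withDensity fun x => ENNReal.ofReal (gammaPDFReal 1 1 x)) = _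
  rw [lintegral_withDensity_eq_lintegral_mul _ (measurable_gammaPDFReal 1 1).ennreal_ofReal hh,
    ← lintegral_indicator measurableSet_Ioi]
  refine lintegral_congr_ae ?_
  filter_upwards [compl_mem_ae_iff.2 (measure_singleton (0 : ℝ))] with r hr
  rw [mem_compl_singleton_iff] at hr
  rw [Pi.mul_apply]
  change gammaPDF 1 1 r * h r = _
  by_cases h0 : 0 < r
  · rw [indicator_of_mem (by exact h0), gammaPDF_of_nonneg h0.le]
    simp
  · rw [indicator_of_notMem (by exact h0), gammaPDF_of_neg (lt_of_le_of_ne (not_lt.1 h0) hr),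
      zero_mul]

theorem lintegral_comp_add_expMeasure_one {h : ℝ → ℝ≥0∞} (hh : Measurable h) (s : ℝ) :
    ∫⁻ r, h (s + r) ∂(expMeasure 1) =
      ∫⁻ u, (Ioi s).indicator (fun u => ENNReal.ofReal (Real.exp (-(u - s))) * h u) u := by
  rw [lintegral_expMeasure_one (by fun_prop), ← lintegral_indicator measurableSet_Ioi]
  conv_rhs => rw [← lintegral_add_left_eq_self _ s]
  refine lintegral_congr fun r => ?_
  simp only [indicator, mem_Ioi, lt_add_iff_pos_right, add_sub_cancel_left]

theorem expMeasure_one_Ioi {a : ℝ} (ha : 0 ≤ a) :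
    expMeasure 1 (Ioi a) = ENNReal.ofReal (Real.exp (-a)) := by
  rw [← lintegral_indicator_one measurableSet_Ioi,
    lintegral_expMeasure_one (measurable_one.indicator measurableSet_Ioi)]
  have h1 : ∀ r, ENNReal.ofReal (Real.exp (-r)) * (Ioi a).indicator 1 r =
      (Ioi a).indicator (fun r => ENNReal.ofReal (Real.exp (-r))) r := by
    intro r
    by_cases hr : r ∈ Ioi a <;> simp [hr]
  simp only [h1]
  rw [setLIntegral_indicator measurableSet_Ioi,
    inter_eq_left.2 (Ioi_subset_Ioi ha),
    ← ofReal_integral_eq_lintegral_ofReal (integrableOn_exp_neg_Ioi a)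
      (Eventually.of_forall fun r => (Real.exp_pos _).le), integral_exp_neg_Ioi]

theorem lintegral_Ioo_sub_pow_div_factorial {a b : ℝ} (hab : a ≤ b) (n : ℕ) :
    ∫⁻ s in Ioo a b, ENNReal.ofReal ((s - a) ^ n / n.factorial) =
      ENNReal.ofReal ((b - a) ^ (n + 1) / (n + 1).factorial) := by
  rw [restrict_Ioo_eq_restrict_Ioc, ← ofReal_integral_eq_lintegral_ofReal]
  · rw [← intervalIntegral.integral_of_le hab, intervalIntegral.integral_div,
      intervalIntegral.integral_comp_sub_right (fun s => s ^ n), integral_pow, Nat.factorial_succ]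
    push_cast
    rw [sub_self, zero_pow (by omega), sub_zero, div_div]
  · refine (intervalIntegrable_iff_integrableOn_Ioc_of_le hab).1 ?_
    exact Continuous.intervalIntegrable (by fun_prop) _ _
  · filter_upwards [ae_restrict_mem measurableSet_Ioc] with s hs
    exact div_nonneg (pow_nonneg (by linarith [hs.1]) _) (by positivity)

variable {Ω : Type*} [MeasurableSpace Ω] {P : Measure Ω} {t₀ : ℝ} {T : ℕ → Ω → ℝ}

theorem IsPoissonJumpTimes.eq_add_sum (hT : IsPoissonJumpTimes P t₀ T) (n : ℕ) :
    T n = fun ω => t₀ + ∑ k ∈ Finset.range n, (T (k + 1) ω - T k ω) := by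
  funext ω
  rw [Finset.sum_range_sub (fun k => T k ω), hT.start]
  ring

/-- `T n` is a function of the first `n` increments, hence independent of the next one. -/
theorem IsPoissonJumpTimes.lintegral_increment [IsProbabilityMeasure P]
    (hT : IsPoissonJumpTimes P t₀ T) (n : ℕ)
    {h : ℝ → ℝ → ℝ≥0∞} (hh : Measurable (Function.uncurry h)) :
    ∫⁻ ω, h (T n ω) (T (n + 1) ω - T n ω) ∂P =
      ∫⁻ ω, ∫⁻ r, h (T n ω) r ∂(expMeasure 1) ∂P := by
  have hm : ∀ k, Measurable fun ω => T (k + 1) ω - T k ω := fun k =>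
    (hT.measurable _).sub (hT.measurable _)
  have hi : IndepFun (T n) (fun ω => T (n + 1) ω - T n ω) P := by
    have h1 := hT.indep.indepFun_finsetSum_of_notMem hm
      (s := Finset.range n) (i := n) (by simp)
    have h2 := h1.comp (φ := fun x => t₀ + x) (ψ := id) (by fun_prop) measurable_id
    have h3 : T n = (fun x => t₀ + x) ∘ ∑ k ∈ Finset.range n, fun ω => T (k + 1) ω - T k ω := by
      rw [hT.eq_add_sum n]
      funext ω
      simp [Finset.sum_apply]
    rw [← h3] at h2
    exact h2
  have hprod := (indepFun_iff_map_prod_eq_prod_map_map (hT.measurable n).aemeasurable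
    (hm n).aemeasurable).1 hi
  have hp : IsProbabilityMeasure (expMeasure 1) := isProbabilityMeasure_expMeasure one_pos
  rw [hT.law] at hprod
  calc ∫⁻ ω, h (T n ω) (T (n + 1) ω - T n ω) ∂P
      = ∫⁻ z, Function.uncurry h z ∂(P.map fun ω => (T n ω, T (n + 1) ω - T n ω)) := by
        rw [lintegral_map hh ((hT.measurable n).prodMk (hm n))]; rfl
    _ = _ := by
        rw [hprod, lintegral_prod _ hh.aemeasurable, lintegral_map _ (hT.measurable n)]
        · rfl
        · exact hh.lintegral_prod_right'

/-- The jump times have Gamma distributions. -/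
theorem IsPoissonJumpTimes.lintegral_succ [IsProbabilityMeasure P]
    (hT : IsPoissonJumpTimes P t₀ T) (n : ℕ) {h : ℝ → ℝ≥0∞} (hh : Measurable h) :
    ∫⁻ ω, h (T (n + 1) ω) ∂P = ∫⁻ s, (Ioi t₀).indicator (fun s =>
      ENNReal.ofReal ((s - t₀) ^ n / n.factorial * Real.exp (-(s - t₀))) * h s) s := by
  -- Given `T n = s`, the next jump has density `e^{-(u-s)}` on `u > s`.
  have hstep : ∀ n (h : ℝ → ℝ≥0∞), Measurable h → ∫⁻ ω, h (T (n + 1) ω) ∂P =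
      ∫⁻ ω, (∫⁻ u, (Ioi (T n ω)).indicator
        (fun u => ENNReal.ofReal (Real.exp (-(u - T n ω))) * h u) u) ∂P := by
    intro n h hh
    have := hT.lintegral_increment n (h := fun s r => h (s + r)) (by fun_prop)
    simp only [add_sub_cancel] at this
    rw [this]
    exact lintegral_congr fun ω => lintegral_comp_add_expMeasure_one hh _
  induction n generalizing h with
  | zero =>
    rw [hstep 0 h hh]
    simp [hT.start]
  | succ n ih =>
    have hmeas : Measurable (Function.uncurry fun s u : ℝ => (Ioi s).indicator
        (fun u => ENNReal.ofReal (Real.exp (-(u - s))) * h u) u) := by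
      have : (Function.uncurry fun s u : ℝ => (Ioi s).indicator
          (fun u => ENNReal.ofReal (Real.exp (-(u - s))) * h u) u) =
          {p : ℝ × ℝ | p.1 < p.2}.indicator
            (fun p => ENNReal.ofReal (Real.exp (-(p.2 - p.1))) * h p.2) := rfl
      rw [this]
      exact Measurable.indicator (by fun_prop) (measurableSet_lt measurable_fst measurable_snd)
    rw [hstep (n + 1) h hh, ih (h := fun s => ∫⁻ u, (Ioi s).indicator
      (fun u => ENNReal.ofReal (Real.exp (-(u - s))) * h u) u) hmeas.lintegral_prod_right']
    -- The exponentials combine to `e^{-(u-t₀)}`, free of `s`. After Tonelli only `(s-t₀)^n / n!` is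
    -- integrated over `(t₀, u)`, giving the next Gamma density.
    have h1 : ∀ s, (Ioi t₀).indicator (fun s =>
        ENNReal.ofReal ((s - t₀) ^ n / n.factorial * Real.exp (-(s - t₀))) *
          ∫⁻ u, (Ioi s).indicator
            (fun u => ENNReal.ofReal (Real.exp (-(u - s))) * h u) u) s =
        ∫⁻ u, (Ioi t₀).indicator (fun u => ENNReal.ofReal (Real.exp (-(u - t₀))) * h u *
          (Ioo t₀ u).indicator (fun s => ENNReal.ofReal ((s - t₀) ^ n / n.factorial)) s) u := by
      intro s
      by_cases hs : t₀ < s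
      · rw [indicator_of_mem (by exact hs), ← lintegral_const_mul']
        · refine lintegral_congr fun u => ?_
          by_cases hu : s < u
          · rw [indicator_of_mem (by exact hu), indicator_of_mem (by exact hs.trans hu),
              indicator_of_mem (by exact ⟨hs, hu⟩), ← mul_assoc, ← ENNReal.ofReal_mul
                (mul_nonneg (div_nonneg (pow_nonneg (by linarith) _) (by positivity))
                  (Real.exp_pos _).le), mul_assoc, ← Real.exp_add, mul_comm _ (Real.exp _),
              ENNReal.ofReal_mul (Real.exp_pos _).le, mul_right_comm]
            ring_nf
          · rw [indicator_of_notMem (by exact hu), mul_zero]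
            by_cases hu' : t₀ < u
            · rw [indicator_of_mem (by exact hu'), indicator_of_notMem (fun hc => hu hc.2),
                mul_zero]
            · rw [indicator_of_notMem (by exact hu')]
        · exact ENNReal.ofReal_ne_top
      · rw [indicator_of_notMem (by exact hs)]
        symm
        refine lintegral_eq_zero_of_ae_eq_zero (Eventually.of_forall fun u => ?_)
        by_cases hu' : t₀ < u
        · rw [indicator_of_mem (by exact hu'), indicator_of_notMem (fun hc => hs hc.1),
            mul_zero]; rfl
        · rw [indicator_of_notMem (by exact hu')]; rfl
    simp only [h1]
    rw [lintegral_lintegral_swap]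
    · refine lintegral_congr fun u => ?_
      by_cases hu : t₀ < u
      · simp only [indicator_of_mem (show u ∈ Ioi t₀ from hu)]
        rw [lintegral_const_mul, lintegral_indicator measurableSet_Ioo,
          lintegral_Ioo_sub_pow_div_factorial hu.le, mul_right_comm,
          ← ENNReal.ofReal_mul (Real.exp_pos _).le, mul_comm (Real.exp _)]
        exact Measurable.indicator (by fun_prop) measurableSet_Ioo
      · simp [indicator_of_notMem (show u ∉ Ioi t₀ from hu)]
    · have : (Function.uncurry fun s u : ℝ => (Ioi t₀).indicator (fun u =>
          ENNReal.ofReal (Real.exp (-(u - t₀))) * h u *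
          (Ioo t₀ u).indicator (fun s => ENNReal.ofReal ((s - t₀) ^ n / n.factorial)) s) u) =
          {p : ℝ × ℝ | t₀ < p.2}.indicator
            (fun p => ENNReal.ofReal (Real.exp (-(p.2 - t₀))) * h p.2 *
              {p : ℝ × ℝ | t₀ < p.1 ∧ p.1 < p.2}.indicator
                (fun p => ENNReal.ofReal ((p.1 - t₀) ^ n / n.factorial)) p) := rfl
      rw [this]
      refine Measurable.aemeasurable (Measurable.indicator (Measurable.mul (by fun_prop)
        (Measurable.indicator (by fun_prop) ?_)) (measurableSet_lt measurable_const measurable_snd))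
      exact (measurableSet_lt measurable_const measurable_fst).inter
        (measurableSet_lt measurable_fst measurable_snd)

/-- The event that exactly `n` jumps have occurred at time `t`. -/
def jumpEvent (T : ℕ → Ω → ℝ) (t : ℝ) (n : ℕ) : Set Ω := {ω | T n ω ≤ t ∧ t < T (n + 1) ω}

theorem IsPoissonJumpTimes.measurableSet_jumpEvent (hT : IsPoissonJumpTimes P t₀ T) (t : ℝ)
    (n : ℕ) : MeasurableSet (jumpEvent T t n) :=
  (measurableSet_le (hT.measurable n) measurable_const).inter
    (measurableSet_lt measurable_const (hT.measurable _))

/-- Given `T n = s ≤ t`, the next increment exceeds `t - s` with probability `e^{-(t-s)}`. -/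
theorem IsPoissonJumpTimes.setLIntegral_jumpEvent [IsProbabilityMeasure P]
    (hT : IsPoissonJumpTimes P t₀ T) (t : ℝ) (n : ℕ) {h : ℝ → ℝ≥0∞} (hh : Measurable h) :
    ∫⁻ ω in jumpEvent T t n, h (T n ω) ∂P =
      ∫⁻ ω, (Iic t).indicator (fun s => ENNReal.ofReal (Real.exp (-(t - s))) * h s) (T n ω) ∂P := by
  have h1 := hT.lintegral_increment n
    (h := fun s r => {p : ℝ × ℝ | p.1 ≤ t ∧ t - p.1 < p.2}.indicator (fun p => h p.1) (s, r)) (by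
      refine Measurable.indicator (by fun_prop) ?_
      exact (measurableSet_le measurable_fst measurable_const).inter
        (measurableSet_lt (by fun_prop) measurable_snd))
  rw [← lintegral_indicator (hT.measurableSet_jumpEvent t n)]
  refine Eq.trans (lintegral_congr fun ω => ?_) (h1.trans (lintegral_congr fun ω => ?_))
  · by_cases hω : ω ∈ jumpEvent T t n
    · rw [indicator_of_mem hω, indicator_of_mem]
      exact ⟨hω.1, sub_lt_sub_right hω.2 _⟩
    · rw [indicator_of_notMem hω, indicator_of_notMem]
      exact fun hc => hω ⟨hc.1, (sub_lt_sub_iff_right _).1 hc.2⟩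
  · by_cases hω : T n ω ≤ t
    · rw [indicator_of_mem (by exact hω), ← expMeasure_one_Ioi (by linarith), mul_comm,
        ← lintegral_indicator_const measurableSet_Ioi]
      refine lintegral_congr fun r => ?_
      simp [indicator, hω]
    · simp [indicator, hω]

theorem IsPoissonJumpTimes.measure_jumpEvent_zero [IsProbabilityMeasure P]
    (hT : IsPoissonJumpTimes P t₀ T) {t : ℝ} (ht : t₀ ≤ t) :
    P.real (jumpEvent T t 0) = Real.exp (-(t - t₀)) := by
  have h := hT.setLIntegral_jumpEvent t 0 (h := fun _ => 1) measurable_const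
  simp only [hT.start, lintegral_const, Measure.restrict_apply_univ, measure_univ,
    indicator_of_mem (show t₀ ∈ Iic t from ht), one_mul, mul_one] at h
  rw [measureReal_def, h, ENNReal.toReal_ofReal (Real.exp_pos _).le]

/-- The Gamma factor `e^{-(s-t₀)}` and the survival factor `e^{-(t-s)}` multiply to the constant
`e^{-(t-t₀)}`, which the prefactor of the final formula removes. -/
theorem IsPoissonJumpTimes.map_restrict_jumpEvent_succ [IsProbabilityMeasure P]
    (hT : IsPoissonJumpTimes P t₀ T) (t : ℝ) (n : ℕ) :
    (P.restrict (jumpEvent T t (n + 1))).map (T (n + 1)) =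
      (volume.restrict (Ioc t₀ t)).withDensity fun s =>
        ENNReal.ofReal (Real.exp (-(t - t₀)) * ((s - t₀) ^ n / n.factorial)) := by
  refine Measure.ext_of_lintegral _ fun h hh => ?_
  rw [lintegral_map hh (hT.measurable _), hT.setLIntegral_jumpEvent t _ hh,
    hT.lintegral_succ n (Measurable.indicator (by fun_prop) measurableSet_Iic),
    lintegral_withDensity_eq_lintegral_mul _ (by fun_prop) hh,
    ← lintegral_indicator measurableSet_Ioc]
  refine lintegral_congr fun s => ?_
  by_cases h1 : t₀ < s
  · rw [indicator_of_mem (by exact h1)]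
    by_cases h2 : s ≤ t
    · rw [indicator_of_mem (by exact h2), indicator_of_mem (by exact ⟨h1, h2⟩), Pi.mul_apply,
        ← mul_assoc, ← ENNReal.ofReal_mul (mul_nonneg (div_nonneg (pow_nonneg (by linarith) _)
          (by positivity)) (Real.exp_pos _).le), mul_assoc, ← Real.exp_add, mul_comm _ (Real.exp _)]
      ring_nf
    · rw [indicator_of_notMem (by exact h2), indicator_of_notMem (fun h => h2 h.2), mul_zero]
  · rw [indicator_of_notMem (by exact h1), indicator_of_notMem (fun h => h1 h.1)]

theorem IsPoissonJumpTimes.setIntegral_jumpEvent_succ [IsProbabilityMeasure P]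
    (hT : IsPoissonJumpTimes P t₀ T) {t : ℝ} (ht : t₀ ≤ t) (n : ℕ) {h : ℝ → ℝ}
    (hh : Measurable h) :
    ∫ ω in jumpEvent T t (n + 1), h (T (n + 1) ω) ∂P =
      ∫ s in t₀..t, Real.exp (-(t - t₀)) * ((s - t₀) ^ n / n.factorial) * h s := by
  rw [← integral_map (hT.measurable _).aemeasurable hh.aestronglyMeasurable,
    hT.map_restrict_jumpEvent_succ t n,
    integral_withDensity_eq_integral_toReal_smul (by fun_prop)
      (Eventually.of_forall fun _ => ENNReal.ofReal_lt_top),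
    intervalIntegral.integral_of_le ht]
  refine setIntegral_congr_fun measurableSet_Ioc fun s hs => ?_
  simp only [smul_eq_mul]
  rw [ENNReal.toReal_ofReal]
  exact mul_nonneg (Real.exp_pos _).le (div_nonneg (pow_nonneg (by linarith [hs.1]) _)
    (by positivity))

theorem IsPoissonJumpTimes.measureReal_jumpEvent_succ_le [IsProbabilityMeasure P]
    (hT : IsPoissonJumpTimes P t₀ T) {t : ℝ} (ht : t₀ ≤ t) (n : ℕ) :
    P.real (jumpEvent T t (n + 1)) ≤ (t - t₀) ^ (n + 1) / (n + 1).factorial := by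
  have h := hT.setIntegral_jumpEvent_succ ht n (h := fun _ => 1) measurable_const
  have h1 : (∫ ω in jumpEvent T t (n + 1), (1 : ℝ) ∂P) = P.real (jumpEvent T t (n + 1)) := by
    simp
  rw [← h1, h]
  simp only [mul_one]
  rw [intervalIntegral.integral_const_mul, intervalIntegral.integral_div,
    intervalIntegral.integral_comp_sub_right (fun s => s ^ n), integral_pow, sub_self,
    zero_pow (by omega), sub_zero, div_div, Nat.factorial_succ]
  push_cast
  refine mul_le_of_le_one_left (div_nonneg (pow_nonneg (by linarith) _) (by positivity)) ?_
  rw [Real.exp_le_one_iff]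
  linarith

theorem IsPoissonJumpTimes.ae_monotone (hT : IsPoissonJumpTimes P t₀ T) :
    ∀ᵐ ω ∂P, Monotone fun n => T n ω := by
  have h : ∀ n, ∀ᵐ ω ∂P, 0 ≤ T (n + 1) ω - T n ω := by
    intro n
    have hm : Measurable fun ω => T (n + 1) ω - T n ω :=
      (hT.measurable _).sub (hT.measurable _)
    have h1 : ∀ᵐ r ∂(expMeasure 1), (0 : ℝ) ≤ r := by
      rw [ae_iff]
      simp only [not_le]
      change expMeasure 1 (Iio 0) = 0
      rw [← lintegral_indicator_one measurableSet_Iio,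
        lintegral_expMeasure_one (measurable_one.indicator measurableSet_Iio)]
      refine lintegral_eq_zero_of_ae_eq_zero ?_
      filter_upwards [ae_restrict_mem measurableSet_Ioi] with r hr
      simp [indicator_of_notMem (show r ∉ Iio 0 from not_lt.2 (le_of_lt (mem_Ioi.1 hr)))]
    rw [← hT.law n] at h1
    exact ae_of_ae_map hm.aemeasurable h1
  filter_upwards [ae_all_iff.2 h] with ω hω
  exact monotone_nat_of_le_succ fun n => sub_nonneg.1 (hω n)

/-- Having all jumps before `t` is at most as likely as having `n + 1` of them, and that probability
is at most `(t-t₀)^(n+1) / (n+1)!`. -/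
theorem IsPoissonJumpTimes.ae_exists_gt [IsProbabilityMeasure P]
    (hT : IsPoissonJumpTimes P t₀ T) {t : ℝ} (ht : t₀ ≤ t) :
    ∀ᵐ ω ∂P, ∃ n, t < T n ω := by
  rw [ae_iff]
  simp only [not_exists, not_lt]
  have hle : ∀ n, P {ω | ∀ n, T n ω ≤ t} ≤
      ENNReal.ofReal ((t - t₀) ^ (n + 1) / (n + 1).factorial) := by
    intro n
    calc P {ω | ∀ n, T n ω ≤ t} ≤ P {ω | T (n + 1) ω ≤ t} := measure_mono fun ω hω => hω _
      _ = ∫⁻ ω, (Iic t).indicator 1 (T (n + 1) ω) ∂P := by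
          rw [← lintegral_indicator_one (measurableSet_le (hT.measurable _) measurable_const)]
          rfl
      _ ≤ ∫⁻ s in Ioc t₀ t, ENNReal.ofReal ((s - t₀) ^ n / n.factorial) := by
          rw [hT.lintegral_succ n (measurable_one.indicator measurableSet_Iic),
            ← lintegral_indicator measurableSet_Ioc]
          refine lintegral_mono fun s => ?_
          by_cases h1 : t₀ < s
          · rw [indicator_of_mem (by exact h1)]
            by_cases h2 : s ≤ t
            · rw [indicator_of_mem (by exact h2), indicator_of_mem (by exact ⟨h1, h2⟩)]
              simp only [Pi.one_apply, mul_one]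
              refine ENNReal.ofReal_le_ofReal (mul_le_of_le_one_right
                (div_nonneg (pow_nonneg (by linarith) _) (by positivity)) ?_)
              rw [Real.exp_le_one_iff]
              linarith
            · rw [indicator_of_notMem (by exact h2), mul_zero]
              exact zero_le
          · rw [indicator_of_notMem (by exact h1)]
            exact zero_le
      _ = _ := by
          rw [← restrict_Ioo_eq_restrict_Ioc, lintegral_Ioo_sub_pow_div_factorial ht]
  have hlim : Tendsto (fun n : ℕ => ENNReal.ofReal ((t - t₀) ^ (n + 1) / (n + 1).factorial))
      atTop (𝓝 0) := by
    have := (FloorSemiring.tendsto_pow_div_factorial_atTop (t - t₀)).comp (tendsto_add_atTop_nat 1)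
    simpa using (ENNReal.tendsto_ofReal this)
  exact le_antisymm (ge_of_tendsto' hlim hle) zero_le

end Poisson

/-! ### The Markov chain at an independent random time. -/

section MarkovChain

open Filter Topology

/-- The point with index `m` of the grid of mesh `1 / (k + 1)` to the right of `t₀`. -/
def gridPoint (t₀ : ℝ) (k m : ℕ) : ℝ := t₀ + (m + 1) / (k + 1)

/-- The index of the first grid point to the right of `r`. -/
def gridIndex (t₀ : ℝ) (k : ℕ) (r : ℝ) : ℕ := ⌊(r - t₀) * (k + 1)⌋₊

theorem le_gridPoint (t₀ : ℝ) (k m : ℕ) : t₀ ≤ gridPoint t₀ k m := by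
  have : (0 : ℝ) ≤ (m + 1) / (k + 1) := by positivity
  rw [gridPoint]
  linarith

theorem le_gridPoint_gridIndex (t₀ : ℝ) (k : ℕ) (r : ℝ) :
    r ≤ gridPoint t₀ k (gridIndex t₀ k r) := by
  have h := (Nat.lt_floor_add_one ((r - t₀) * (k + 1))).le
  have hk : (0 : ℝ) < k + 1 := by positivity
  have := (le_div_iff₀ hk).2 h
  rw [gridPoint, gridIndex]
  linarith

theorem gridPoint_gridIndex_le {t₀ r : ℝ} (hr : t₀ ≤ r) (k : ℕ) :
    gridPoint t₀ k (gridIndex t₀ k r) ≤ r + 1 / (k + 1) := by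
  have hk : (0 : ℝ) < k + 1 := by positivity
  have h := Nat.floor_le (mul_nonneg (sub_nonneg.2 hr) hk.le)
  have := (div_le_iff₀ hk).2 h
  rw [gridPoint, gridIndex, add_div]
  linarith

theorem tendsto_gridPoint_gridIndex {t₀ r : ℝ} (hr : t₀ ≤ r) :
    Tendsto (fun k => gridPoint t₀ k (gridIndex t₀ k r)) atTop (𝓝[≥] r) := by
  refine tendsto_nhdsWithin_iff.2 ⟨?_, Eventually.of_forall fun k => le_gridPoint_gridIndex t₀ k r⟩
  refine tendsto_of_tendsto_of_tendsto_of_le_of_le tendsto_const_nhds ?_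
    (fun k => le_gridPoint_gridIndex t₀ k r) (fun k => gridPoint_gridIndex_le hr k)
  simpa using (tendsto_one_div_add_atTop_nhds_zero_nat (𝕜 := ℝ)).const_add r

theorem gridIndex_mono (t₀ : ℝ) (k : ℕ) : Monotone (gridIndex t₀ k) := fun a b h => by
  refine Nat.floor_le_floor (mul_le_mul_of_nonneg_right (by linarith) (by positivity))

variable {Ω : Type*} [MeasurableSpace Ω] {P : Measure Ω} {t₀ : ℝ} {d : ℕ}
  {A : Matrix (Fin d) (Fin d) ℝ} {X : ℝ → Ω → Fin d}

theorem IsMarkovChain.measureReal_pair (hX : IsMarkovChain P t₀ A X) {s : ℝ} (hs : t₀ ≤ s)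
    (i j : Fin d) : P.real ({ω | X t₀ ω = i} ∩ {ω | X s ω = j}) =
      P.real {ω | X t₀ ω = i} * NormedSpace.exp ((s - t₀) • A) i j := by
  have h := hX.fdd 1 (fun k => if k = 0 then t₀ else s) (fun k => if k = 0 then i else j)
    (fun a b hab => by
      by_cases ha : a = 0
      · by_cases hb : b = 0 <;> simp [ha, hb, hs]
      · have hb : b ≠ 0 := by omega
        simp [ha, hb]) (by simp)
  simp only [Finset.range_one, Finset.prod_singleton, if_true, zero_add, one_ne_zero,
    if_false] at h
  rw [← h]
  congr 1
  ext ω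
  constructor
  · rintro ⟨h0, h1⟩ k hk
    obtain rfl | rfl : k = 0 ∨ k = 1 := by omega
    · simpa using h0
    · simpa using h1
  · intro hω
    exact ⟨by simpa using hω 0 (by omega), by simpa using hω 1 le_rfl⟩

/-- The entry is a conditional probability, since the state `i` is charged. -/
theorem IsMarkovChain.exp_mem_Icc [IsProbabilityMeasure P] (hX : IsMarkovChain P t₀ A X)
    {i : Fin d} (hi : P.real {ω | X t₀ ω = i} ≠ 0) {r : ℝ} (hr : 0 ≤ r) (j : Fin d) :
    NormedSpace.exp (r • A) i j ∈ Icc (0 : ℝ) 1 := by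
  have h := hX.measureReal_pair (s := t₀ + r) (by linarith) i j
  rw [add_sub_cancel_left] at h
  have hpos : 0 < P.real {ω | X t₀ ω = i} := lt_of_le_of_ne measureReal_nonneg hi.symm
  constructor
  · exact nonneg_of_mul_nonneg_right (h ▸ measureReal_nonneg) hpos
  · refine le_of_mul_le_mul_left ?_ hpos
    rw [← h, mul_one]
    exact measureReal_mono inter_subset_left

/-- The grid points approach `r` from the right, and convergence in a discrete space means being
eventually constant. -/
theorem IsMarkovChain.eventually_eq (hX : IsMarkovChain P t₀ A X) {r : ℝ} (hr : t₀ ≤ r) (ω : Ω) :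
    ∀ᶠ k in atTop, X (gridPoint t₀ k (gridIndex t₀ k r)) ω = X r ω := by
  have h := (hX.rightCts ω r hr).tendsto.comp (tendsto_gridPoint_gridIndex hr)
  exact (tendsto_pure.1 (by simpa [nhds_discrete] using h))

variable {β : Type*} [MeasurableSpace β] {V : Ω → β} {u : β → ℝ} {b : ℝ} {Φ : β → ℝ}

theorem IsMarkovChain.setIntegral_of_indepFun [IsProbabilityMeasure P]
    (hX : IsMarkovChain P t₀ A X) (hV : Measurable V)
    (hind : IndepFun (fun ω (s : Ici t₀) => X s ω) V P) (hΦ : Measurable Φ) {s : ℝ} (hs : t₀ ≤ s)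
    (i j : Fin d) :
    ∫ ω in {ω | X t₀ ω = i}, {ω | X s ω = j}.indicator (fun ω => Φ (V ω)) ω ∂P =
      P.real {ω | X t₀ ω = i} * ∫ ω, Φ (V ω) * NormedSpace.exp ((s - t₀) • A) i j ∂P := by
  have hmi : MeasurableSet {ω | X t₀ ω = i} :=
    hX.measurable t₀ le_rfl (measurableSet_singleton i)
  have hmj : MeasurableSet {ω | X s ω = j} := hX.measurable s hs (measurableSet_singleton j)
  set B : Set (Ici t₀ → Fin d) :=
    {p | p ⟨t₀, mem_Ici.2 le_rfl⟩ = i} ∩ {p | p ⟨s, hs⟩ = j} with hBdef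
  have hev : ∀ r : Ici t₀, Measurable fun p : Ici t₀ → Fin d => p r := measurable_pi_apply
  have hB : MeasurableSet B :=
    (hev _ (measurableSet_singleton i)).inter (hev _ (measurableSet_singleton j))
  have hψ : Measurable (B.indicator fun _ => (1 : ℝ)) := measurable_const.indicator hB
  have h1 := (hind.symm.comp hΦ hψ).integral_fun_mul_eq_mul_integral
    (hΦ.comp hV).aestronglyMeasurable
    (hψ.comp (measurable_pi_lambda _ fun s => hX.measurable s s.2)).aestronglyMeasurable
  have h2 : (B.indicator fun _ => (1 : ℝ)) ∘ (fun ω (s : Ici t₀) => X s ω) =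
      ({ω | X t₀ ω = i} ∩ {ω | X s ω = j}).indicator (fun _ => (1 : ℝ)) := rfl
  rw [h2, integral_indicator_const _ (hmi.inter hmj), hX.measureReal_pair hs, smul_eq_mul,
    mul_one] at h1
  rw [← integral_indicator hmi, integral_mul_const, mul_left_comm]
  refine Eq.trans (integral_congr_ae (Eventually.of_forall fun ω => ?_)) h1
  by_cases h3 : X t₀ ω = i <;> by_cases h4 : X s ω = j <;> simp [indicator, h3, h4]

/-- The random time is rounded up to a grid. It then takes finitely many values, because `u ≤ b`,
and each is covered by the deterministic case. Right-continuity and domination by `|Φ(V)|` remove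
the rounding. -/
theorem IsMarkovChain.setIntegral_random_time [IsProbabilityMeasure P]
    (hX : IsMarkovChain P t₀ A X) (hV : Measurable V)
    (hind : IndepFun (fun ω (s : Ici t₀) => X s ω) V P) (hu : Measurable u)
    (hub : ∀ v, u v ∈ Icc t₀ b) (hΦ : Measurable Φ) (hint : Integrable (fun ω => Φ (V ω)) P)
    {i : Fin d} (hi : P.real {ω | X t₀ ω = i} ≠ 0) (j : Fin d) :
    Integrable (fun ω => if X (u (V ω)) ω = j then Φ (V ω) else 0) P ∧
    ∫ ω in {ω | X t₀ ω = i}, (if X (u (V ω)) ω = j then Φ (V ω) else 0) ∂P =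
      P.real {ω | X t₀ ω = i} *
        ∫ ω, Φ (V ω) * NormedSpace.exp ((u (V ω) - t₀) • A) i j ∂P := by
  set F : ℕ → Ω → ℝ := fun k ω =>
    if X (gridPoint t₀ k (gridIndex t₀ k (u (V ω)))) ω = j then Φ (V ω) else 0 with hF
  set G : ℕ → Ω → ℝ := fun k ω => Φ (V ω) *
    NormedSpace.exp ((gridPoint t₀ k (gridIndex t₀ k (u (V ω))) - t₀) • A) i j with hG
  have hidx : ∀ k, Measurable (gridIndex t₀ k) := fun k =>
    Nat.measurable_floor.comp (by fun_prop)
  have hφ : ∀ k m, Measurable fun v => if gridIndex t₀ k (u v) = m then Φ v else 0 := fun k m =>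
    Measurable.ite (((hidx k).comp hu) (measurableSet_singleton m)) hΦ measurable_const
  have hφint : ∀ k m, Integrable
      (fun ω => if gridIndex t₀ k (u (V ω)) = m then Φ (V ω) else 0) P := fun k m =>
    hint.mono ((hφ k m).comp hV).aestronglyMeasurable (Eventually.of_forall fun ω => by
      split_ifs <;> simp)
  have hmj : ∀ k m, MeasurableSet {ω | X (gridPoint t₀ k m) ω = j} := fun k m =>
    hX.measurable _ (le_gridPoint t₀ k m) (measurableSet_singleton j)
  have hmem : ∀ k v, gridIndex t₀ k (u v) ∈ Finset.range (gridIndex t₀ k b + 1) := fun k v =>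
    Finset.mem_range.2 (Nat.lt_succ_of_le (gridIndex_mono t₀ k (hub v).2))
  have hFsum : ∀ k, F k = fun ω => ∑ m ∈ Finset.range (gridIndex t₀ k b + 1),
      {ω | X (gridPoint t₀ k m) ω = j}.indicator
        (fun ω => if gridIndex t₀ k (u (V ω)) = m then Φ (V ω) else 0) ω := by
    intro k
    funext ω
    rw [Finset.sum_eq_single (gridIndex t₀ k (u (V ω)))]
    · simp [hF, indicator]
    · intro m _ hm
      simp [indicator, Ne.symm hm]
    · exact fun h => absurd (hmem k (V ω)) h
  have hGsum : ∀ k, G k = fun ω => ∑ m ∈ Finset.range (gridIndex t₀ k b + 1),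
      (if gridIndex t₀ k (u (V ω)) = m then Φ (V ω) else 0) *
        NormedSpace.exp ((gridPoint t₀ k m - t₀) • A) i j := by
    intro k
    funext ω
    rw [Finset.sum_eq_single (gridIndex t₀ k (u (V ω)))]
    · simp [hG]
    · intro m _ hm
      simp [Ne.symm hm]
    · exact fun h => absurd (hmem k (V ω)) h
  have hFint : ∀ k, Integrable (F k) P := fun k => by
    rw [hFsum k]
    exact integrable_finsetSum _ fun m _ => (hφint k m).indicator (hmj k m)
  have hFG : ∀ k, ∫ ω in {ω | X t₀ ω = i}, F k ω ∂P =
      P.real {ω | X t₀ ω = i} * ∫ ω, G k ω ∂P := by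
    intro k
    rw [hFsum k, hGsum k, integral_finsetSum _ fun m _ =>
      ((hφint k m).indicator (hmj k m)).integrableOn, integral_finsetSum _ fun m _ =>
      (hφint k m).mul_const _, Finset.mul_sum]
    exact Finset.sum_congr rfl fun m _ =>
      hX.setIntegral_of_indepFun hV hind (hφ k m) (le_gridPoint t₀ k m) i j
  have hFlim : ∀ ω, Tendsto (fun k => F k ω) atTop
      (𝓝 (if X (u (V ω)) ω = j then Φ (V ω) else 0)) := fun ω => by
    refine tendsto_const_nhds.congr' ?_
    filter_upwards [hX.eventually_eq (hub (V ω)).1 ω] with k hk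
    simp only [hF, hk]
  have hGlim : ∀ ω, Tendsto (fun k => G k ω) atTop
      (𝓝 (Φ (V ω) * NormedSpace.exp ((u (V ω) - t₀) • A) i j)) := fun ω => by
    refine Tendsto.const_mul _ ?_
    have h1 := tendsto_nhds_of_tendsto_nhdsWithin
      (tendsto_gridPoint_gridIndex (t₀ := t₀) (hub (V ω)).1)
    exact ((continuous_exp_smul_apply A i j).tendsto _).comp (h1.sub_const t₀)
  have hFb : ∀ k ω, ‖F k ω‖ ≤ ‖Φ (V ω)‖ := fun k ω => by
    simp only [hF]
    split_ifs <;> simp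
  have hGb : ∀ k ω, ‖G k ω‖ ≤ ‖Φ (V ω)‖ := fun k ω => by
    have h1 := hX.exp_mem_Icc hi (sub_nonneg.2 (le_gridPoint t₀ k (gridIndex t₀ k (u (V ω))))) j
    simp only [hG]
    rw [norm_mul, Real.norm_of_nonneg h1.1]
    exact mul_le_of_le_one_right (norm_nonneg _) h1.2
  have hGm : ∀ k, AEStronglyMeasurable (G k) P := fun k => by
    rw [hGsum k]
    exact (integrable_finsetSum _ fun m _ => (hφint k m).mul_const _).1
  -- The chain is measurable only at each fixed time; at the random time measurability comes from
  -- the limit.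
  refine ⟨hint.mono (aestronglyMeasurable_of_tendsto_ae atTop (fun k => (hFint k).1)
    (Eventually.of_forall hFlim)) (Eventually.of_forall fun ω => by split_ifs <;> simp), ?_⟩
  have l1 := tendsto_integral_of_dominated_convergence (μ := P.restrict {ω | X t₀ ω = i})
    (fun ω => ‖Φ (V ω)‖) (fun k => (hFint k).1.restrict) hint.norm.integrableOn
    (fun k => Eventually.of_forall (hFb k)) (Eventually.of_forall hFlim)
  have l2 := tendsto_integral_of_dominated_convergence (μ := P)
    (fun ω => ‖Φ (V ω)‖) hGm hint.norm
    (fun k => Eventually.of_forall (hGb k)) (Eventually.of_forall hGlim)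
  simp only [hFG] at l1
  exact tendsto_nhds_unique l1 (l2.const_mul _)

end MarkovChain

/-! ### Uniform attachment. -/

section Attachment

open Filter LabelledTree

variable {Ω : Type*} [MeasurableSpace Ω] {P : Measure Ω} {η : ℕ → Ω → ℕ}

/-- Only the first `n` labels matter, and every function on a finite product of copies of `ℕ` is
measurable. -/
theorem measurable_comp_grow (H : LabelledTree → ℝ) (n : ℕ) :
    Measurable fun l : ℕ → ℕ => H (grow l n) := by
  have h : (fun l : ℕ → ℕ => H (grow l n)) =
      (fun l : Finset.range n → ℕ =>
        H (grow (fun k => if hk : k ∈ Finset.range n then l ⟨k, hk⟩ else 0) n)) ∘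
      fun l k => l k := by
    funext l
    refine congrArg H (grow_congr n fun k hk => ?_)
    simp [hk]
  rw [h]
  exact Measurable.of_discrete.comp (by fun_prop)

theorem IsUniformAttachment.measurable_grow (hη : IsUniformAttachment P η)
    (H : LabelledTree → ℝ) (n : ℕ) : Measurable fun ω => H (grow (fun k => η k ω) n) :=
  (measurable_comp_grow H n).comp (measurable_pi_lambda _ hη.measurable)

theorem IsUniformAttachment.measure_eq (hη : IsUniformAttachment P η) {n l : ℕ}
    (hl : l ∈ Finset.Icc 1 (n + 1)) : P.real (η n ⁻¹' {l}) = ((n : ℝ) + 1)⁻¹ := by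
  rw [← map_measureReal_apply (hη.measurable n) (measurableSet_singleton l), hη.law,
    measureReal_def, ← Finset.coe_Icc, ← Finset.coe_singleton, uniformOn_apply_finset,
    Finset.inter_singleton_of_mem hl]
  simp
  norm_cast

theorem IsUniformAttachment.ae_mem (hη : IsUniformAttachment P η) :
    ∀ᵐ ω ∂P, ∀ k, η k ω ∈ Finset.Icc 1 (k + 1) := by
  refine ae_all_iff.2 fun k => ?_
  have h : ∀ᵐ l ∂(uniformOn (Icc 1 (k + 1)) : Measure ℕ), l ∈ Finset.Icc 1 (k + 1) := by
    filter_upwards [ae_cond_mem (μ := Measure.count) (measurableSet_Icc (a := 1) (b := k + 1))]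
      with l hl
    simpa using hl
  rw [← hη.law k] at h
  exact ae_of_ae_map (hη.measurable k).aemeasurable h

theorem IsUniformAttachment.integrable_grow [IsProbabilityMeasure P]
    (hη : IsUniformAttachment P η) (H : LabelledTree → ℝ) (n : ℕ) :
    Integrable (fun ω => H (grow (fun k => η k ω) n)) P := by
  refine Integrable.of_bound (hη.measurable_grow H n).aestronglyMeasurable
    ((growths n).map fun τ => |H τ|).sum ?_
  filter_upwards [hη.ae_mem] with ω hω
  exact Multiset.single_le_sum (fun x hx => by
    obtain ⟨τ, -, rfl⟩ := Multiset.mem_map.1 hx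
    exact abs_nonneg _) _ (Multiset.mem_map.2 ⟨_, grow_mem_growths n fun k _ => hω k, rfl⟩)

/-- All `n!` admissible label sequences are equally likely. Inductively, the last label is
independent of the tree grown so far and takes each of its `n + 1` values with probability `1 / (n +
1)`. -/
theorem IsUniformAttachment.integral_grow [IsProbabilityMeasure P]
    (hη : IsUniformAttachment P η) (H : LabelledTree → ℝ) (n : ℕ) :
    n.factorial * ∫ ω, H (grow (fun k => η k ω) n) ∂P = ((growths n).map H).sum := by
  induction n generalizing H with
  | zero => simp [grow, growths]
  | succ n ih =>
    have hind : ∀ l, ∫ ω, H ((grow (fun k => η k ω) n).attach l (n + 2)) *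
          (η n ⁻¹' {l}).indicator (fun _ => (1 : ℝ)) ω ∂P =
        (∫ ω, H ((grow (fun k => η k ω) n).attach l (n + 2)) ∂P) * P.real (η n ⁻¹' {l}) := by
      intro l
      have h1 := hη.indep.indepFun_finset (Finset.range n) {n} (by simp) hη.measurable
      have h2 := h1.comp
        (φ := fun l' : Finset.range n → ℕ => H ((grow (fun k =>
          if hk : k ∈ Finset.range n then l' ⟨k, hk⟩ else 0) n).attach l (n + 2)))
        (ψ := fun l' : ({n} : Finset ℕ) → ℕ =>
          ({l} : Set ℕ).indicator (fun _ => (1 : ℝ)) (l' ⟨n, Finset.mem_singleton_self n⟩))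
        Measurable.of_discrete Measurable.of_discrete
      have h3 : ((fun l' : Finset.range n → ℕ => H ((grow (fun k =>
          if hk : k ∈ Finset.range n then l' ⟨k, hk⟩ else 0) n).attach l (n + 2))) ∘
          fun ω (i : Finset.range n) => η i ω) =
          fun ω => H ((grow (fun k => η k ω) n).attach l (n + 2)) := by
        funext ω
        refine congrArg (fun τ => H (attach l (n + 2) τ)) (grow_congr n fun k hk => ?_)
        simp [hk]
      have h4 : ((fun l' : ({n} : Finset ℕ) → ℕ =>
          ({l} : Set ℕ).indicator (fun _ => (1 : ℝ)) (l' ⟨n, Finset.mem_singleton_self n⟩)) ∘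
          fun ω (i : ({n} : Finset ℕ)) => η i ω) = (η n ⁻¹' {l}).indicator (fun _ => (1 : ℝ)) := by
        funext ω
        simp [indicator]
      rw [h3, h4] at h2
      have hm : MeasurableSet (η n ⁻¹' {l}) := hη.measurable n (measurableSet_singleton l)
      rw [h2.integral_fun_mul_eq_mul_integral
        (hη.measurable_grow (fun τ => H (τ.attach l (n + 2))) n).aestronglyMeasurable
        (measurable_const.indicator hm).aestronglyMeasurable, integral_indicator_const _ hm]
      simp
    have hsplit : ∫ ω, H (grow (fun k => η k ω) (n + 1)) ∂P =
        ∫ ω, ∑ l ∈ Finset.Icc 1 (n + 1), H ((grow (fun k => η k ω) n).attach l (n + 2)) *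
          (η n ⁻¹' {l}).indicator (fun _ => (1 : ℝ)) ω ∂P := by
      refine integral_congr_ae ?_
      filter_upwards [hη.ae_mem] with ω hω
      rw [Finset.sum_eq_single (η n ω)]
      · simp [grow]
      · intro l _ hl
        simp [indicator, Ne.symm hl]
      · exact fun h => absurd (hω n) h
    rw [hsplit, integral_finsetSum]
    · have h5 : ∀ l ∈ Finset.Icc 1 (n + 1), ∫ ω, H ((grow (fun k => η k ω) n).attach l (n + 2)) *
          (η n ⁻¹' {l}).indicator (fun _ => (1 : ℝ)) ω ∂P =
          (∫ ω, H ((grow (fun k => η k ω) n).attach l (n + 2)) ∂P) * ((n : ℝ) + 1)⁻¹ :=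
        fun l hl => by rw [hind l, hη.measure_eq hl]
      rw [Finset.sum_congr rfl h5, ← Finset.sum_mul, Nat.factorial_succ, growths,
        Multiset.map_bind, Multiset.sum_bind]
      have h6 := ih fun τ => ∑ l ∈ Finset.Icc 1 (n + 1), H (τ.attach l (n + 2))
      rw [integral_finsetSum _ fun l _ =>
        hη.integrable_grow (fun τ => H (τ.attach l (n + 2))) n] at h6
      simp only [Multiset.map_map, Function.comp_def]
      refine Eq.trans ?_ h6
      push_cast
      have : (n : ℝ) + 1 ≠ 0 := by positivity
      field_simp
    · intro l _
      exact ((hη.integrable_grow (fun τ => H (τ.attach l (n + 2))) n).indicator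
        (hη.measurable n (measurableSet_singleton l))).congr (Eventually.of_forall fun ω => by
          by_cases h : η n ω = l <;> simp [indicator, h])

end Attachment

/-! ### Integrability of a series of functions. -/

section Integrability

open Filter Topology
open scoped ENNReal

theorem integrable_tsum_of_summable_integral_norm {α : Type*} [MeasurableSpace α] {μ : Measure α}
    {F : ℕ → α → ℝ} (hF : ∀ n, Integrable (F n) μ) (hs : Summable fun n => ∫ a, ‖F n a‖ ∂μ) :
    Integrable (fun a => ∑' n, F n a) μ := by
  have hfin : ∫⁻ a, ∑' n, ‖F n a‖ₑ ∂μ < ∞ := by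
    rw [lintegral_tsum fun n => (hF n).1.enorm]
    simp only [← ofReal_integral_norm_eq_lintegral_enorm (hF _)]
    rw [← ENNReal.ofReal_tsum_of_nonneg (fun n => integral_nonneg fun _ => norm_nonneg _) hs]
    exact ENNReal.ofReal_lt_top
  have hae : ∀ᵐ a ∂μ, Summable fun n => F n a := by
    filter_upwards [ae_lt_top' (AEMeasurable.tsum fun n => (hF n).1.enorm) hfin.ne]
      with a ha
    refine Summable.of_norm ?_
    have h1 := ENNReal.summable_toReal ha.ne
    simpa using h1
  refine ⟨aestronglyMeasurable_of_tendsto_ae atTop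
    (f := fun N a => ∑ n ∈ Finset.range N, F n a)
    (fun N => (integrable_finsetSum _ fun n _ => hF n).1) ?_, ?_⟩
  · filter_upwards [hae] with a ha
    exact ha.hasSum.tendsto_sum_nat
  · refine lt_of_le_of_lt (lintegral_mono_ae ?_) hfin
    filter_upwards [hae] with a ha
    exact enorm_tsum_le_tsum_enorm

end Integrability

/-! ### The counting process and the order of the tree. -/

section JumpCount

variable {Ω : Type*} {T : ℕ → Ω → ℝ} {t : ℝ} {ω : Ω}

theorem jumpCount_eq_of_mem_jumpEvent (hT : Monotone fun n => T n ω) {n : ℕ}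
    (h : ω ∈ jumpEvent T t n) : jumpCount T t ω = n := by
  have : {k : ℕ | 1 ≤ k ∧ T k ω ≤ t} = (Finset.Icc 1 n : Finset ℕ) := by
    ext k
    simp only [mem_ofPred_eq, Finset.coe_Icc, mem_Icc, and_congr_right_iff]
    refine fun _ => ⟨fun hk => ?_, fun hk => (hT hk).trans h.1⟩
    by_contra hlt
    exact absurd ((h.2.trans_le (hT (by omega : n + 1 ≤ k))).trans_le hk) (lt_irrefl t)
  rw [jumpCount, this, ncard_coe_finset]
  simp

theorem exists_mem_jumpEvent (h0 : T 0 ω ≤ t) (h : ∃ n, t < T n ω) : ∃ n, ω ∈ jumpEvent T t n := by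
  classical
  have hpos : Nat.find h ≠ 0 := fun h1 => absurd (h1 ▸ Nat.find_spec h) (not_lt.2 h0)
  obtain ⟨m, hm⟩ := Nat.exists_eq_succ_of_ne_zero hpos
  refine ⟨m, not_lt.1 (Nat.find_min h (by omega)), ?_⟩
  have := Nat.find_spec h
  rwa [hm] at this

end JumpCount

/-- Admissibility matters: attaching to an absent label leaves the tree unchanged. -/
theorem order_attachmentTree {l : ℕ → ℕ} (hl : ∀ k, l k ∈ Finset.Icc 1 (k + 1)) (n : ℕ) :
    (attachmentTree l n).order = n := by
  cases n with
  | zero => rfl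
  | succ n =>
    exact LabelledTree.order_of_mem_growths (LabelledTree.grow_mem_growths n fun k _ => hl k)

/-! ### Contribution of each number of jumps. -/

section Stages

open Filter

variable {d : ℕ} (A : Matrix (Fin d) (Fin d) ℝ)
  (g : EuclideanSpace ℝ (Fin d) → EuclideanSpace ℝ (Fin d)) (t₀ : ℝ)
  (x₀ : EuclideanSpace ℝ (Fin d)) (t : ℝ)

/-- The value, at state `j`, of the functional on the event of exactly `n` jumps, as a function
of jump times and attachment labels. -/
def stageCoeff (n : ℕ) (j : Fin d) (v : (ℕ → ℝ) × (ℕ → ℕ)) : ℝ :=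
  ((n - 1).factorial * ((attachmentTree v.2 n).elemDiffOf (semilinearField A g) g x₀) j) *
    {τ : ℕ → ℝ | τ n ≤ t ∧ t < τ (n + 1)}.indicator (fun _ => 1) v.1

/-- The time at which the Markov chain is evaluated after exactly `n` jumps. -/
def stageTime (n : ℕ) (v : (ℕ → ℝ) × (ℕ → ℕ)) : ℝ := max t₀ (min t (t₀ + t - v.1 n))

/-- A bound for the elementary differentials of order `n`. -/
def stageBound (C : ℝ) : ℕ → ℝ
  | 0 => ‖x₀‖
  | n + 1 => C ^ (n + 1)

variable {Ω : Type*} [MeasurableSpace Ω]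

/-- The contribution of the event of exactly `n` jumps to the tree functional. -/
def stage (T : ℕ → Ω → ℝ) (η : ℕ → Ω → ℕ) (X : ℝ → Ω → Fin d) (n : ℕ) (ω : Ω) : ℝ :=
  ∑ j, if X (stageTime t₀ t n (fun k => T k ω, fun k => η k ω)) ω = j then
    stageCoeff A g x₀ t n j (fun k => T k ω, fun k => η k ω) else 0

variable {A g t₀ x₀ t} {P : Measure Ω} {T : ℕ → Ω → ℝ} {η : ℕ → Ω → ℕ} {X : ℝ → Ω → Fin d}
  {C : ℝ}

theorem measurableSet_jumpSet (n : ℕ) :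
    MeasurableSet {τ : ℕ → ℝ | τ n ≤ t ∧ t < τ (n + 1)} :=
  (measurableSet_le (measurable_pi_apply n) measurable_const).inter
    (measurableSet_lt measurable_const (measurable_pi_apply (n + 1)))

theorem measurable_elemDiffOf_attachmentTree
    (f h : EuclideanSpace ℝ (Fin d) → EuclideanSpace ℝ (Fin d)) (n : ℕ) (j : Fin d) :
    Measurable fun l : ℕ → ℕ => ((attachmentTree l n).elemDiffOf f h x₀) j := by
  cases n with
  | zero => exact (measurable_const : Measurable fun _ : ℕ → ℕ => x₀ j)
  | succ n =>
    exact measurable_comp_grow (fun τ => (ButcherTree.elemDiffOf f h (some τ.forget) x₀) j) n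

theorem measurable_stageCoeff (n : ℕ) (j : Fin d) : Measurable (stageCoeff A g x₀ t n j) :=
  (((measurable_elemDiffOf_attachmentTree _ _ n j).comp measurable_snd).const_mul _).mul
    ((measurable_const.indicator (measurableSet_jumpSet n)).comp measurable_fst)

theorem measurable_stageTime (n : ℕ) : Measurable (stageTime t₀ t n) := by
  unfold stageTime
  fun_prop

/-- The truncation keeps the evaluation time bounded for all `v`, as the random time lemma demands;
on the event of `n` jumps it is almost surely inactive. -/
theorem stageTime_mem_Icc (ht : t₀ ≤ t) (n : ℕ) (v : (ℕ → ℝ) × (ℕ → ℕ)) :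
    stageTime t₀ t n v ∈ Icc t₀ t :=
  ⟨le_max_left _ _, max_le ht (min_le_left _ _)⟩

theorem abs_stageCoeff_le (hC : 0 < C) (hgb : ∀ m, ‖iteratedFDeriv ℝ m g x₀‖ ≤ C)
    (hfb : ∀ m, ‖iteratedFDeriv ℝ m (semilinearField A g) x₀‖ ≤ C) {v : (ℕ → ℝ) × (ℕ → ℕ)}
    (hv : ∀ k, v.2 k ∈ Finset.Icc 1 (k + 1)) (n : ℕ) (j : Fin d) :
    |stageCoeff A g x₀ t n j v| ≤ ((n - 1).factorial * stageBound x₀ C n) *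
      {τ : ℕ → ℝ | τ n ≤ t ∧ t < τ (n + 1)}.indicator (fun _ => 1) v.1 := by
  have h1 : ‖(attachmentTree v.2 n).elemDiffOf (semilinearField A g) g x₀‖ ≤ stageBound x₀ C n := by
    cases n with
    | zero => exact le_rfl
    | succ n =>
      have := norm_elemDiffOf_le hC.le hfb hgb (LabelledTree.grow v.2 n).forget
      rwa [LabelledTree.order_of_mem_growths
        (LabelledTree.grow_mem_growths n fun k _ => hv k)] at this
  have h0 : (0 : ℝ) ≤ {τ : ℕ → ℝ | τ n ≤ t ∧ t < τ (n + 1)}.indicator (fun _ => 1) v.1 :=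
    indicator_nonneg (fun _ _ => zero_le_one) _
  rw [stageCoeff, abs_mul, abs_mul, Nat.abs_cast, abs_of_nonneg h0]
  gcongr
  exact (PiLp.norm_apply_le _ j).trans h1

omit [MeasurableSpace Ω] in
theorem indicator_jumpSet (n : ℕ) (ω : Ω) :
    {τ : ℕ → ℝ | τ n ≤ t ∧ t < τ (n + 1)}.indicator (fun _ => (1 : ℝ)) (fun k => T k ω) =
      (jumpEvent T t n).indicator (fun _ => 1) ω := rfl

theorem integrable_stageCoeff [IsProbabilityMeasure P] (hT : IsPoissonJumpTimes P t₀ T)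
    (hη : IsUniformAttachment P η) (hC : 0 < C)
    (hgb : ∀ m, ‖iteratedFDeriv ℝ m g x₀‖ ≤ C)
    (hfb : ∀ m, ‖iteratedFDeriv ℝ m (semilinearField A g) x₀‖ ≤ C) (n : ℕ) (j : Fin d) :
    Integrable (fun ω => stageCoeff A g x₀ t n j (fun k => T k ω, fun k => η k ω)) P := by
  refine Integrable.mono'
    (g := fun ω => ((n - 1).factorial * stageBound x₀ C n) *
      (jumpEvent T t n).indicator (fun _ => 1) ω)
    (((integrable_const _).indicator (hT.measurableSet_jumpEvent t n)).const_mul _)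
    ((measurable_stageCoeff n j).comp ((measurable_pi_lambda _ hT.measurable).prodMk
      (measurable_pi_lambda _ hη.measurable))).aestronglyMeasurable ?_
  filter_upwards [hη.ae_mem] with ω hω
  exact abs_stageCoeff_le hC hgb hfb hω n j

-- The sum over states in `stage` makes each coefficient a function of times and labels alone, hence
-- independent of the chain.
omit [MeasurableSpace Ω] in
theorem stage_eq (n : ℕ) (ω : Ω) : stage A g t₀ x₀ t T η X n ω =
    stageCoeff A g x₀ t n (X (stageTime t₀ t n (fun k => T k ω, fun k => η k ω)) ω)
      (fun k => T k ω, fun k => η k ω) := by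
  rw [stage, Finset.sum_ite_eq, if_pos (Finset.mem_univ _)]

theorem ae_treeFunctional_eq_tsum_stage [IsProbabilityMeasure P]
    (hT : IsPoissonJumpTimes P t₀ T) (hη : IsUniformAttachment P η) (ht : t₀ ≤ t) :
    ∀ᵐ ω ∂P, treeFunctional A g t₀ x₀ T η X t ω = ∑' n, stage A g t₀ x₀ t T η X n ω := by
  filter_upwards [hT.ae_monotone, hT.ae_exists_gt ht, hη.ae_mem] with ω h1 h2 h3
  obtain ⟨n, hn⟩ := exists_mem_jumpEvent (by rw [hT.start]; exact ht) h2
  have hcount := jumpCount_eq_of_mem_jumpEvent h1 hn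
  rw [tsum_eq_single n]
  · have h0 : t₀ ≤ T n ω := by
      have := h1 (Nat.zero_le n)
      simpa [hT.start] using this
    have htime : stageTime t₀ t n (fun k => T k ω, fun k => η k ω) = t₀ + t - T n ω := by
      have h4 : T n ω ≤ t := hn.1
      rw [stageTime, min_eq_right (by linarith), max_eq_right (by linarith)]
    rw [stage_eq, htime, stageCoeff, indicator_jumpSet, indicator_of_mem hn]
    simp only [treeFunctional, randomTree, hcount, order_attachmentTree h3 n]
    rw [if_pos hn.1]
  · intro m hm
    rw [stage_eq, stageCoeff, indicator_jumpSet, indicator_of_notMem, mul_zero]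
    exact fun h => hm ((jumpCount_eq_of_mem_jumpEvent h1 h).symm.trans hcount)

/-- The weight `n!` is absorbed by the jump probability, at most `(t-t₀)^(n+1) / (n+1)!`. Stage 0,
with its bound `‖x₀‖`, is left out. -/
theorem integral_norm_stage_le [IsProbabilityMeasure P] (hT : IsPoissonJumpTimes P t₀ T)
    (hη : IsUniformAttachment P η) (hC : 0 < C)
    (hgb : ∀ m, ‖iteratedFDeriv ℝ m g x₀‖ ≤ C)
    (hfb : ∀ m, ‖iteratedFDeriv ℝ m (semilinearField A g) x₀‖ ≤ C) (ht : t₀ ≤ t) (n : ℕ) :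
    ∫ ω, ‖stage A g t₀ x₀ t T η X (n + 1) ω‖ ∂P ≤ (C * (t - t₀)) ^ (n + 1) := by
  have h1 : ∫ ω, ‖stage A g t₀ x₀ t T η X (n + 1) ω‖ ∂P ≤
      ∫ ω, (n.factorial * C ^ (n + 1)) * (jumpEvent T t (n + 1)).indicator (fun _ => 1) ω ∂P := by
    refine integral_mono_of_nonneg (Eventually.of_forall fun _ => norm_nonneg _)
      (((integrable_const _).indicator (hT.measurableSet_jumpEvent t _)).const_mul _) ?_
    filter_upwards [hη.ae_mem] with ω hω
    rw [stage_eq]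
    exact abs_stageCoeff_le hC hgb hfb hω (n + 1) _
  rw [integral_const_mul, integral_indicator_const _ (hT.measurableSet_jumpEvent t _), smul_eq_mul,
    mul_one] at h1
  have h0 : 0 ≤ t - t₀ := sub_nonneg.2 ht
  calc _ ≤ _ := h1
    _ ≤ n.factorial * C ^ (n + 1) * ((t - t₀) ^ (n + 1) / (n + 1).factorial) := by
        gcongr
        exact hT.measureReal_jumpEvent_succ_le ht n
    _ = (n.factorial / (n + 1).factorial) * (C * (t - t₀)) ^ (n + 1) := by
        rw [mul_pow]; ring
    _ ≤ 1 * (C * (t - t₀)) ^ (n + 1) := by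
        gcongr
        rw [div_le_one (by positivity)]
        exact_mod_cast Nat.factorial_le (Nat.le_succ n)
    _ = _ := one_mul _

theorem integral_stageCoeff_zero [IsProbabilityMeasure P] (hT : IsPoissonJumpTimes P t₀ T)
    (ht : t₀ ≤ t) (i j : Fin d) :
    ∫ ω, stageCoeff A g x₀ t 0 j (fun k => T k ω, fun k => η k ω) *
        NormedSpace.exp ((stageTime t₀ t 0 (fun k => T k ω, fun k => η k ω) - t₀) • A) i j ∂P =
      Real.exp (-(t - t₀)) * (NormedSpace.exp ((t - t₀) • A) i j * x₀ j) := by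
  have h : ∀ ω, stageCoeff A g x₀ t 0 j (fun k => T k ω, fun k => η k ω) *
        NormedSpace.exp ((stageTime t₀ t 0 (fun k => T k ω, fun k => η k ω) - t₀) • A) i j =
      (NormedSpace.exp ((t - t₀) • A) i j * x₀ j) *
        (jumpEvent T t 0).indicator (fun _ => 1) ω := by
    intro ω
    have htime : stageTime t₀ t 0 (fun k => T k ω, fun k => η k ω) = t := by
      simp [stageTime, hT.start, ht]
    rw [htime, stageCoeff, indicator_jumpSet]
    simp only [attachmentTree, ButcherTree.elemDiffOf, id, zero_tsub, Nat.factorial_zero,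
      Nat.cast_one, one_mul]
    ring
  simp only [h]
  rw [integral_const_mul, integral_indicator_const _ (hT.measurableSet_jumpEvent t _),
    hT.measure_jumpEvent_zero ht, smul_eq_mul, mul_one, mul_comm]

/-- Times and labels are independent, so the integral factorizes. The weight `n!` turns the mean
over trees into the Lie derivative, while the `1 / n!` of the jump density remains as the Taylor
factor. -/
theorem integral_stageCoeff_succ [IsProbabilityMeasure P] (hg : AnalyticOnNhd ℝ g univ)
    (hT : IsPoissonJumpTimes P t₀ T)
    (hη : IsUniformAttachment P η)
    (hTη : IndepFun (fun ω n => T n ω) (fun ω k => η k ω) P)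
    (ht : t₀ ≤ t) (n : ℕ) (i j : Fin d) :
    ∫ ω, stageCoeff A g x₀ t (n + 1) j (fun k => T k ω, fun k => η k ω) *
        NormedSpace.exp ((stageTime t₀ t (n + 1) (fun k => T k ω, fun k => η k ω) - t₀) • A)
          i j ∂P =
      Real.exp (-(t - t₀)) * ∫ s in t₀..t, NormedSpace.exp ((t - s) • A) i j *
        ((s - t₀) ^ n / n.factorial * ((lieDeriv (semilinearField A g))^[n] g x₀) j) := by
  set f := semilinearField A g with hf
  have hfc : ContDiff ℝ ⊤ f :=
    contDiff_omega_iff_analyticOnNhd.2 (analyticOnNhd_semilinearField hg)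
  have hgc : ContDiff ℝ ⊤ g := contDiff_omega_iff_analyticOnNhd.2 hg
  set h : ℝ → ℝ := fun s => NormedSpace.exp ((max t₀ (min t (t₀ + t - s)) - t₀) • A) i j with hh
  have hhm : Measurable h :=
    ((continuous_exp_smul_apply A i j).comp
      (by fun_prop : Continuous fun s => max t₀ (min t (t₀ + t - s)) - t₀)).measurable
  set φ : (ℕ → ℝ) → ℝ := {τ : ℕ → ℝ | τ (n + 1) ≤ t ∧ t < τ (n + 1 + 1)}.indicator
    (fun τ => h (τ (n + 1))) with hφ
  have hφm : Measurable φ :=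
    (hhm.comp (measurable_pi_apply _)).indicator (measurableSet_jumpSet (n + 1))
  set ψ : (ℕ → ℕ) → ℝ := fun l =>
    (ButcherTree.elemDiffOf f g (some (LabelledTree.grow l n).forget) x₀) j with hψ
  have hψm : Measurable ψ := measurable_comp_grow
    (fun τ => (ButcherTree.elemDiffOf f g (some τ.forget) x₀) j) n
  have h1 := (hTη.comp hφm hψm).integral_fun_mul_eq_mul_integral
    (hφm.comp (measurable_pi_lambda _ hT.measurable)).aestronglyMeasurable
    (hψm.comp (measurable_pi_lambda _ hη.measurable)).aestronglyMeasurable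
  have h2 : ∫ ω, (φ ∘ fun ω k => T k ω) ω ∂P =
      ∫ s in t₀..t, Real.exp (-(t - t₀)) * ((s - t₀) ^ n / n.factorial) * h s := by
    rw [← hT.setIntegral_jumpEvent_succ ht n hhm,
      ← integral_indicator (hT.measurableSet_jumpEvent t _)]
    rfl
  have h3 : n.factorial * ∫ ω, (ψ ∘ fun ω k => η k ω) ω ∂P = ((lieDeriv f)^[n] g x₀) j := by
    have := hη.integral_grow
      (fun τ => (ButcherTree.elemDiffOf f g (some τ.forget) x₀) j) n
    rw [iterate_lieDeriv hfc hgc]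
    refine this.trans ?_
    have h4 := map_multiset_sum (EuclideanSpace.proj (𝕜 := ℝ) j)
      ((LabelledTree.growths n).map fun τ => ButcherTree.elemDiffOf f g (some τ.forget) x₀)
    rw [Multiset.map_map] at h4
    exact h4.symm
  have h4 : ∀ ω, stageCoeff A g x₀ t (n + 1) j (fun k => T k ω, fun k => η k ω) *
        NormedSpace.exp ((stageTime t₀ t (n + 1) (fun k => T k ω, fun k => η k ω) - t₀) • A)
          i j = n.factorial * ((φ ∘ fun ω k => T k ω) ω * (ψ ∘ fun ω k => η k ω) ω) := by
    intro ω
    by_cases hω : T (n + 1) ω ≤ t ∧ t < T (n + 1 + 1) ω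
    · have hm : (fun k => T k ω) ∈ {τ : ℕ → ℝ | τ (n + 1) ≤ t ∧ t < τ (n + 1 + 1)} := hω
      simp only [stageCoeff, stageTime, Function.comp_apply, hφ, hψ, hh, indicator_of_mem hm,
        add_tsub_cancel_right, attachmentTree, ← hf]
      ring
    · have hm : (fun k => T k ω) ∉ {τ : ℕ → ℝ | τ (n + 1) ≤ t ∧ t < τ (n + 1 + 1)} := hω
      simp only [stageCoeff, Function.comp_apply, hφ, indicator_of_notMem hm]
      ring
  simp only [h4]
  rw [integral_const_mul, h1, mul_left_comm, h3, h2, ← intervalIntegral.integral_mul_const,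
    ← intervalIntegral.integral_const_mul]
  refine intervalIntegral.integral_congr fun s hs => ?_
  rw [uIcc_of_le ht] at hs
  have h5 : max t₀ (min t (t₀ + t - s)) - t₀ = t - s := by
    rw [min_eq_right (by linarith [hs.1]), max_eq_right (by linarith [hs.2])]
    ring
  simp only [hh, h5]
  ring

end Stages

end

/-! ### Assembly of the formula. -/

theorem mainTheorem2 {d : ℕ} (A : Matrix (Fin d) (Fin d) ℝ) (hA : IsGenerator A)
    (g : EuclideanSpace ℝ (Fin d) → EuclideanSpace ℝ (Fin d))
    (hg : AnalyticOnNhd ℝ g Set.univ)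
    (t₀ : ℝ) (x₀ : EuclideanSpace ℝ (Fin d)) (C : ℝ) (hC : 0 < C)
    (hbound : ∀ m : ℕ, ‖iteratedFDeriv ℝ m g x₀‖ + ‖Matrix.toEuclideanCLM (𝕜 := ℝ) A x₀‖
      + ‖Matrix.toEuclideanCLM (𝕜 := ℝ) A‖ ≤ C)
    {Ω : Type*} [MeasurableSpace Ω] (P : Measure Ω) [IsProbabilityMeasure P]
    (T : ℕ → Ω → ℝ) (hT : IsPoissonJumpTimes P t₀ T)
    (η : ℕ → Ω → ℕ) (hη : IsUniformAttachment P η)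
    (X : ℝ → Ω → Fin d) (hX : IsMarkovChain P t₀ A X)
    (hTη : IndepFun (fun ω n => T n ω) (fun ω k => η k ω) P)
    (hXTη : IndepFun (fun ω (s : Set.Ici t₀) => X s ω)
      (fun ω => ((fun n => T n ω), (fun k => η k ω))) P) :
    (∃ x, SolvesSemilinear A g t₀ x₀ (Set.Ico t₀ (t₀ + 1 / C)) x) ∧
    ∀ (tmax : ℝ) (x : ℝ → EuclideanSpace ℝ (Fin d)),
      SolvesSemilinear A g t₀ x₀ (Set.Icc t₀ tmax) x →
      ∀ t ∈ Set.Icc t₀ tmax, t < t₀ + 1 / C → ∀ i : Fin d, P {ω | X t₀ ω = i} ≠ 0 →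
        Integrable (treeFunctional A g t₀ x₀ T η X t) (P[|{ω | X t₀ ω = i}]) ∧
        x t i = Real.exp (t - t₀) *
          ∫ ω, treeFunctional A g t₀ x₀ T η X t ω ∂(P[|{ω | X t₀ ω = i}]) := by
  have hgb : ∀ m, ‖iteratedFDeriv ℝ m g x₀‖ ≤ C := fun m => by
    linarith [hbound m, norm_nonneg (Matrix.toEuclideanCLM (𝕜 := ℝ) A x₀),
      norm_nonneg (Matrix.toEuclideanCLM (n := Fin d) (𝕜 := ℝ) A)]
  have hfb := norm_iteratedFDeriv_semilinearField_le hg hbound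
  refine ⟨⟨_, solvesSemilinear_seriesSolution hg hC hfb⟩, ?_⟩
  intro tmax x hx t ht htC i hPi
  rw [hx.eq_seriesSolution hg hC hfb ht htC]
  replace ht : t₀ ≤ t := ht.1
  set S : Set Ω := {ω | X t₀ ω = i} with hS
  have hi : P.real S ≠ 0 := (measureReal_ne_zero_iff (measure_ne_top P S)).2 hPi
  have hV : Measurable fun ω => ((fun n => T n ω), (fun k => η k ω)) :=
    (measurable_pi_lambda _ hT.measurable).prodMk (measurable_pi_lambda _ hη.measurable)
  have hterm := fun (n : ℕ) (j : Fin d) =>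
    hX.setIntegral_random_time hV hXTη (measurable_stageTime n)
      (stageTime_mem_Icc ht n) (measurable_stageCoeff n j)
      (integrable_stageCoeff (t := t) hT hη hC hgb hfb n j) hi j
  have hint : ∀ n, Integrable (stage A g t₀ x₀ t T η X n) P := fun n =>
    integrable_finsetSum _ fun j _ => (hterm n j).1
  have hsummable : Summable fun n => ∫ ω, ‖stage A g t₀ x₀ t T η X n ω‖ ∂P := by
    refine (summable_nat_add_iff 1).1 (Summable.of_nonneg_of_le
      (fun n => integral_nonneg fun _ => norm_nonneg _)
      (fun n => integral_norm_stage_le hT hη hC hgb hfb ht n)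
      -- The ratio `C (t - t₀)` is below 1 exactly because `t < t₀ + 1 / C`.
      ((summable_nat_add_iff 1).2 (summable_geometric_of_lt_one
        (mul_nonneg hC.le (sub_nonneg.2 ht)) ?_)))
    rw [mul_comm, ← lt_div_iff₀ hC]
    linarith
  have hae := ae_treeFunctional_eq_tsum_stage (A := A) (g := g) (x₀ := x₀) (X := X) hT hη ht
  have hZ : Integrable (treeFunctional A g t₀ x₀ T η X t) P :=
    (integrable_tsum_of_summable_integral_norm hint hsummable).congr
      (hae.mono fun ω h => h.symm)
  refine ⟨(hZ.integrableOn (s := S)).smul_measure (by simpa using hPi), ?_⟩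
  have hstage : ∀ n, ∫ ω in S, stage A g t₀ x₀ t T η X n ω ∂P = P.real S *
      ∑ j, ∫ ω, stageCoeff A g x₀ t n j (fun k => T k ω, fun k => η k ω) *
        NormedSpace.exp ((stageTime t₀ t n (fun k => T k ω, fun k => η k ω) - t₀) • A) i j ∂P := by
    intro n
    unfold stage
    rw [integral_finsetSum _ fun j _ => (hterm n j).1.integrableOn, Finset.mul_sum]
    exact Finset.sum_congr rfl fun j _ => (hterm n j).2
  have hsum1 : HasSum (fun n => ∫ ω in S, stage A g t₀ x₀ t T η X n ω ∂P)
      (∫ ω in S, treeFunctional A g t₀ x₀ T η X t ω ∂P) := by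
    rw [integral_congr_ae (ae_restrict_of_ae hae)]
    refine hasSum_integral_of_summable_integral_norm (fun n => (hint n).integrableOn)
      (Summable.of_nonneg_of_le (fun n => integral_nonneg fun _ => norm_nonneg _)
        (fun n => ?_) hsummable)
    exact setIntegral_le_integral (hint n).norm (Filter.Eventually.of_forall fun _ => norm_nonneg _)
  have hsum2 := ((hasSum_duhamel hg hC hgb hfb ht htC i).mul_left
    (P.real S * Real.exp (-(t - t₀))))
  have hsucc : ∀ n, ∫ ω in S, stage A g t₀ x₀ t T η X (n + 1) ω ∂P =
      P.real S * Real.exp (-(t - t₀)) * ∫ s in t₀..t, ∑ j, NormedSpace.exp ((t - s) • A) i j *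
        ((s - t₀) ^ n / n.factorial * ((lieDeriv (semilinearField A g))^[n] g x₀) j) := by
    intro n
    rw [hstage, intervalIntegral.integral_finsetSum, mul_assoc,
      Finset.mul_sum _ _ (Real.exp _)]
    · exact congrArg _ (Finset.sum_congr rfl fun j _ =>
        integral_stageCoeff_succ hg hT hη hTη ht n i j)
    · intro j _
      exact (((continuous_exp_smul_apply A i j).comp
        (by fun_prop : Continuous fun s => t - s)).mul (by fun_prop)).intervalIntegrable _ _
  simp only [← hsucc] at hsum2
  -- Stage 0 is the homogeneous term of Duhamel's formula; without it, the stages and the Duhamel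
  -- series coincide term by term.
  have hsum3 := (hasSum_nat_add_iff' 1).2 hsum1
  have heq := hsum3.unique hsum2
  rw [Finset.sum_range_one, hstage 0, Finset.sum_congr rfl fun j _ =>
    integral_stageCoeff_zero (A := A) (g := g) hT ht i j, ← Finset.mul_sum] at heq
  have hcond : ∫ ω, treeFunctional A g t₀ x₀ T η X t ω ∂(P[|S]) =
      (P.real S)⁻¹ * ∫ ω in S, treeFunctional A g t₀ x₀ T η X t ω ∂P := by
    rw [ProbabilityTheory.cond, integral_smul_measure, ENNReal.toReal_inv, smul_eq_mul]
    rfl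
  have hval : ∫ ω in S, treeFunctional A g t₀ x₀ T η X t ω ∂P = P.real S *
      (Real.exp (-(t - t₀)) * seriesSolution (semilinearField A g) t₀ x₀ t i) := by
    linear_combination heq
  rw [hcond, hval, inv_mul_cancel_left₀ hi, ← mul_assoc, ← Real.exp_add, add_neg_cancel,
    Real.exp_zero, one_mul]
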